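/- **Definitions.** A *precubical set* $X$ consists of sets $X_n$ ($n\ge 0$) of $n$-cells and face maps $s_k,t_k:X_n\to X_{n-1}$ ($1\le k\le n$) with $\alpha_k\beta_\ell=\beta_{\ell-1}\alpha_k$ for $k<\ell$ and $\alpha,\beta\in\{s,t\}$; an *embedding* is an injective dimension-preserving map that commutes with all face maps. The *$d$-dimensional bulk* has as $n$-cells the tuples in $\{0,*,1\}^d$ with exactly $n$ entries $*$; $s_k$ and $t_k$ replace the $k$-th entry $*$ by $0$ and $1$, respectively. A precubical set *can be sculpted* if it embeds into some bulk. A *higher-dimensional automaton* (HDA) is a finite precubical set with an initial cell in $X_0$; it is *connected* if every cell is reachable from the initial cell by a path of steps from a lower face $s_kq$ to $q$ and from $q$ to an upper face $t_kq$; it *can be sculpted* if it has an embedding into some bulk that maps the initial cell to $(0,\dots,0)$. The *geometric realization* $|X|$ is the quotient of $\bigsqcup_n X_n\times[0,1]^n$ that identifies $(s_ix,u)$ and $(t_ix,u)$ with $(x,u')$, where $u'$ is $u$ with $0$, respectively $1$, inserted as $i$-th coordinate. Its directed paths form the smallest set of paths that contains the images of the coordinatewise nondecreasing paths in the cubes and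 is closed under concatenation and (not necessarily surjective) monotone reparametrization. A *Euclidean cubical complex* is a finite union $C\subseteq\mathbb R^N$ (some $N\ge 0$) of elementary cubes $\prod_i[a_i,b_i]$ with $a_i,b_i\in\mathbb Z$, $b_i-a_i\in\{0,1\}$; its directed paths are the coordinatewise nondecreasing paths in $C$. A *d-isometry* $|X|\to C$ is a homeomorphism $h$ that maps directed paths to directed paths, has an inverse that does so too, and, for every $n$ and every $n$-cell $x$, with $h_x:[0,1]^n\to C$ the composite of $h$ with the canonical map of the cube of $x$, * preserves Euclidean distances: $\|h_x(u)-h_x(v)\|=\|u-v\|$; * preserves the order of directions: if $j<k$, if changing only the $j$-th coordinate of some point $u\in[0,1]^n$ changes the $a$-th coordinate of $h_x(u)$, and if changing only the $k$-th coordinate of some point $v\in[0,1]^n$ changes the $b$-th coordinate of $h_x(v)$, then $a<b$. $X$ is *Euclidean* if there is a d-isometry of $|X|$ onto some Euclidean cubical complex. **Theorem.** A precubical set can be sculpted if and only if it is Euclidean. Likewise, a connected HDA can be sculpted (with its initial cell) if and only if its underlying precubical set is Euclidean. -/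

import Mathlib

open scoped unitInterval

universe u v

/-! ### Precubical sets -/

/-- A precubical set. `face false k` is the lower face map `s` and `face true k` the upper face map
`t`; the directions of an `n`-cell are numbered by `Fin n`, starting from `0`. -/
structure PrecubicalSet where
  /-- The cells of dimension `n`. -/
  cell : ℕ → Type u
  /-- The face maps. -/
  face : {n : ℕ} → Bool → Fin (n + 1) → cell (n + 1) → cell n
  /-- The identity `α_k β_l = β_{l-1} α_k` for `k < l`, with `k = i` and `l = j + 1`. -/
  face_face : ∀ {n : ℕ} (α β : Bool) (i j : Fin (n + 1)), i ≤ j → ∀ q : cell (n + 2),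
    face α i (face β j.succ q) = face β j (face α i.castSucc q)

namespace PrecubicalSet

/-- A morphism of precubical sets. -/
structure Hom (X : PrecubicalSet.{u}) (Y : PrecubicalSet.{v}) where
  /-- The map on `n`-cells. -/
  app : ∀ n : ℕ, X.cell n → Y.cell n
  /-- Compatibility with the face maps. -/
  app_face : ∀ {n : ℕ} (α : Bool) (i : Fin (n + 1)) (q : X.cell (n + 1)),
    app n (X.face α i q) = Y.face α i (app (n + 1) q)

/-- An embedding is an injective morphism. -/
def Hom.IsEmbedding {X : PrecubicalSet.{u}} {Y : PrecubicalSet.{v}} (f : Hom X Y) : Prop :=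
  ∀ n : ℕ, Function.Injective (f.app n)

end PrecubicalSet

/-! ### Bulks -/

/-- The indices at which a tuple over `{0, executing, 1}` has the value "executing". The value
`some false` stands for `0`, `some true` for `1`, and `none` for "executing". -/
def executing {d : ℕ} (x : Fin d → Option Bool) : Finset (Fin d) :=
  Finset.univ.filter fun i => x i = none

theorem executing_update {d : ℕ} (x : Fin d → Option Bool) (i : Fin d) (α : Bool) :
    executing (Function.update x i (some α)) = (executing x).erase i := by
  ext j
  by_cases h : j = i <;> simp [executing, h]

/-- The `n`-cells of the `d`-dimensional bulk: the tuples with exactly `n` executing entries. -/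
def BulkCell (d n : ℕ) : Type :=
  {x : Fin d → Option Bool // (executing x).card = n}

namespace BulkCell

/-- The position of the `k`-th executing entry, counted from `0`. -/
def position {d n : ℕ} (x : BulkCell d n) (k : Fin n) : Fin d :=
  (executing x.1).orderEmbOfFin x.2 k

theorem position_mem {d n : ℕ} (x : BulkCell d n) (k : Fin n) : x.position k ∈ executing x.1 :=
  Finset.orderEmbOfFin_mem _ _ _

/-- Replace the `k`-th executing entry by `0` or `1`. -/
def face {d n : ℕ} (α : Bool) (k : Fin (n + 1)) (x : BulkCell d (n + 1)) : BulkCell d n :=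
  ⟨Function.update x.1 (x.position k) (some α), by
    rw [executing_update, Finset.card_erase_of_mem (x.position_mem k), x.2]; rfl⟩

theorem position_face {d n : ℕ} (α : Bool) (k : Fin (n + 1)) (x : BulkCell d (n + 1)) (i : Fin n) :
    (x.face α k).position i = x.position (k.succAbove i) := by
  have h := Finset.orderEmbOfFin_unique (s := executing (x.face α k).1) (x.face α k).2
    (f := fun i => x.position (k.succAbove i)) (fun i => by
      change _ ∈ executing (Function.update x.1 (x.position k) (some α))
      rw [executing_update, Finset.mem_erase]
      refine ⟨fun h => ?_, x.position_mem _⟩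
      exact Fin.succAbove_ne k i (((executing x.1).orderEmbOfFin x.2).injective h))
    (fun a b hab => ((executing x.1).orderEmbOfFin x.2).strictMono
      (Fin.strictMono_succAbove k hab))
  exact (congrFun h i).symm

theorem face_face {d n : ℕ} (α β : Bool) (i j : Fin (n + 1)) (hij : i ≤ j)
    (x : BulkCell d (n + 2)) :
    (x.face β j.succ).face α i = (x.face α i.castSucc).face β j := by
  have h1 : j.succ.succAbove i = i.castSucc :=
    Fin.succAbove_of_castSucc_lt _ _ (Fin.castSucc_lt_succ_iff.2 hij)
  have h2 : i.castSucc.succAbove j = j.succ :=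
    Fin.succAbove_of_le_castSucc _ _ (Fin.castSucc_le_castSucc_iff.2 hij)
  have hne : x.position i.castSucc ≠ x.position j.succ := fun h =>
    (Fin.castSucc_lt_succ_iff.2 hij).ne (((executing x.1).orderEmbOfFin x.2).injective h)
  apply Subtype.ext
  change Function.update (Function.update x.1 (x.position j.succ) (some β))
      ((x.face β j.succ).position i) (some α) =
    Function.update (Function.update x.1 (x.position i.castSucc) (some α))
      ((x.face α i.castSucc).position j) (some β)
  rw [position_face, position_face, h1, h2, Function.update_comm hne]

end BulkCell

/-- The `d`-dimensional bulk. -/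
def bulk (d : ℕ) : PrecubicalSet.{0} where
  cell n := BulkCell d n
  face α k x := BulkCell.face α k x
  face_face α β i j hij x := BulkCell.face_face α β i j hij x

/-- The initial state `(0, …, 0)` of the bulk. -/
def bulkInit (d : ℕ) : (bulk d).cell 0 :=
  ⟨fun _ => some false, by simp [executing]⟩

/-! ### Higher-dimensional automata and sculptures -/

/-- A higher-dimensional automaton: a finite precubical set with an initial state. -/
structure HDA extends PrecubicalSet.{u} where
  /-- There are finitely many cells. -/
  finite : Finite (Σ n, cell n)
  /-- The initial state. -/
  init : cell 0

/-- One step of a path: from a lower face of a cell to the cell, or from a cell to an upper face. -/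
inductive PrecubicalSet.Step (X : PrecubicalSet.{u}) : (Σ n, X.cell n) → (Σ n, X.cell n) → Prop
  | start {n : ℕ} (i : Fin (n + 1)) (q : X.cell (n + 1)) :
      Step X ⟨n, X.face false i q⟩ ⟨n + 1, q⟩
  | terminate {n : ℕ} (i : Fin (n + 1)) (q : X.cell (n + 1)) :
      Step X ⟨n + 1, q⟩ ⟨n, X.face true i q⟩

/-- Every cell can be reached from the initial state by a path. -/
def HDA.Connected (Q : HDA.{u}) : Prop :=
  ∀ q : Σ n, Q.cell n, Relation.ReflTransGen Q.toPrecubicalSet.Step ⟨0, Q.init⟩ q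

/-- A higher-dimensional automaton is sculptable if it has an embedding into some bulk that
preserves the initial state. -/
def HDA.Sculptable (Q : HDA.{u}) : Prop :=
  ∃ (d : ℕ) (f : PrecubicalSet.Hom Q.toPrecubicalSet (bulk d)),
    f.IsEmbedding ∧ f.app 0 Q.init = bulkInit d

/-- A precubical set can be sculpted if it has an embedding into some bulk. -/
def PrecubicalSet.Sculptable (X : PrecubicalSet.{u}) : Prop :=
  ∃ (d : ℕ) (f : PrecubicalSet.Hom X (bulk d)), f.IsEmbedding

/-! ### Directed topological spaces -/

/-- The first half of the unit interval, `t ↦ t / 2`. -/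
noncomputable def firstHalf : C(I, I) where
  toFun t := ⟨(t : ℝ) / 2, by constructor <;> linarith [t.2.1, t.2.2]⟩
  continuous_toFun := by fun_prop

/-- The second half of the unit interval, `t ↦ (1 + t) / 2`. -/
noncomputable def secondHalf : C(I, I) where
  toFun t := ⟨(1 + (t : ℝ)) / 2, by constructor <;> linarith [t.2.1, t.2.2]⟩
  continuous_toFun := by fun_prop

/-- A directed structure on a topological space: a set of directed paths that contains the constant
paths and is closed under monotone reparametrization (also by maps that are not onto, which gives
subpaths) and under concatenation (a path both of whose halves are directed is directed). -/
structure DStructure (X : Type u) [TopologicalSpace X] where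
  /-- The directed paths. -/
  paths : Set C(I, X)
  const_mem : ∀ p : X, ContinuousMap.const I p ∈ paths
  reparam_mem : ∀ γ ∈ paths, ∀ ρ : C(I, I), Monotone ρ → γ.comp ρ ∈ paths
  concat_mem : ∀ γ : C(I, X), γ.comp firstHalf ∈ paths → γ.comp secondHalf ∈ paths → γ ∈ paths

/-- A continuous map is directed if it maps directed paths to directed paths. -/
def DStructure.IsDirected {X : Type u} {Y : Type v} [TopologicalSpace X] [TopologicalSpace Y]
    (P : DStructure X) (P' : DStructure Y) (f : C(X, Y)) : Prop :=
  ∀ γ ∈ P.paths, f.comp γ ∈ P'.paths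

/-- A path is monotone if both of its halves are. -/
theorem monotone_of_halves {Y : Type u} [Preorder Y] (g : I → Y)
    (h1 : Monotone (g ∘ firstHalf)) (h2 : Monotone (g ∘ secondHalf)) : Monotone g := by
  have key1 : ∀ s t : I, s ≤ t → (t : ℝ) ≤ 1 / 2 → g s ≤ g t := by
    intro s t hst ht
    have hs : (s : ℝ) ≤ t := hst
    have := h1 (a := ⟨2 * (s : ℝ), by constructor <;> linarith [s.2.1]⟩)
      (b := ⟨2 * (t : ℝ), by constructor <;> linarith [t.2.1]⟩)
      (Subtype.mk_le_mk.2 (by linarith))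
    convert this using 1 <;> (change g _ = g _; congr 1; apply Subtype.ext; simp [firstHalf])
  have key2 : ∀ s t : I, s ≤ t → 1 / 2 ≤ (s : ℝ) → g s ≤ g t := by
    intro s t hst hs'
    have hs : (s : ℝ) ≤ t := hst
    have := h2 (a := ⟨2 * (s : ℝ) - 1, by constructor <;> linarith [s.2.2]⟩)
      (b := ⟨2 * (t : ℝ) - 1, by constructor <;> linarith [t.2.2]⟩)
      (Subtype.mk_le_mk.2 (by linarith))
    convert this using 1 <;> (change g _ = g _; congr 1; apply Subtype.ext; simp [secondHalf])
  intro s t hst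
  rcases le_total (t : ℝ) (1 / 2) with ht | ht
  · exact key1 s t hst ht
  rcases le_total (s : ℝ) (1 / 2) with hs | hs
  · have hm : (1 / 2 : ℝ) ∈ I := by constructor <;> norm_num
    exact (key1 s ⟨1 / 2, hm⟩ hs le_rfl).trans (key2 ⟨1 / 2, hm⟩ t ht le_rfl)
  · exact key2 s t hst hs

/-- A subset of directed Euclidean space, with the coordinatewise nondecreasing paths in it as the
directed paths. -/
def subsetDStructure {N : ℕ} (C : Set (EuclideanSpace ℝ (Fin N))) : DStructure C where
  paths := {γ | ∀ a : Fin N, Monotone fun t : I => (γ t : EuclideanSpace ℝ (Fin N)) a}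
  const_mem _ _ := fun _ _ _ => le_rfl
  reparam_mem _ hγ _ hρ a := (hγ a).comp hρ
  concat_mem _ h1 h2 a := monotone_of_halves _ (h1 a) (h2 a)

/-! ### Geometric realization -/

/-- The endpoint of the unit interval that belongs to lower (`0`) or upper (`1`) faces. -/
def endpoint (α : Bool) : I := if α then 1 else 0

namespace PrecubicalSet

/-- The disjoint union of one cube `[0,1]^n` for every `n`-cell of `X`. -/
abbrev Cubes (X : PrecubicalSet.{u}) : Type u :=
  Σ x : (Σ n, X.cell n), (Fin x.1 → I)

/-- The gluing of a face of a cell into the boundary of the cell. -/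
inductive Glue (X : PrecubicalSet.{u}) : X.Cubes → X.Cubes → Prop
  | face {n : ℕ} (α : Bool) (i : Fin (n + 1)) (x : X.cell (n + 1)) (p : Fin n → I) :
      Glue X ⟨⟨n, X.face α i x⟩, p⟩ ⟨⟨n + 1, x⟩, i.insertNth (endpoint α) p⟩

/-- The geometric realization, with the quotient topology. -/
def Realization (X : PrecubicalSet.{u}) : Type u := Quot X.Glue

instance (X : PrecubicalSet.{u}) : TopologicalSpace X.Realization :=
  inferInstanceAs (TopologicalSpace (Quot X.Glue))

/-- The canonical map of the cube of a cell `x` to the geometric realization. -/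
def cellMap (X : PrecubicalSet.{u}) {n : ℕ} (x : X.cell n) : C(Fin n → I, X.Realization) where
  toFun p := Quot.mk X.Glue ⟨⟨n, x⟩, p⟩
  continuous_toFun :=
    have h : Continuous fun p : Fin n → I => (⟨⟨n, x⟩, p⟩ : X.Cubes) :=
      (continuous_sigmaMk : Continuous
        (Sigma.mk (β := fun x : (Σ n, X.cell n) => (Fin x.1 → I)) ⟨n, x⟩))
    continuous_quot_mk.comp h

/-- The directed paths of the geometric realization: the smallest directed structure that contains
the images of all coordinatewise nondecreasing paths in the cubes. -/
inductive IsDPath (X : PrecubicalSet.{u}) : C(I, X.Realization) → Prop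
  | cell {n : ℕ} (x : X.cell n) (γ : C(I, Fin n → I)) (hγ : Monotone γ) :
      IsDPath X ((X.cellMap x).comp γ)
  | reparam (γ : C(I, X.Realization)) (hγ : IsDPath X γ) (ρ : C(I, I)) (hρ : Monotone ρ) :
      IsDPath X (γ.comp ρ)
  | concat (γ : C(I, X.Realization)) (h1 : IsDPath X (γ.comp firstHalf))
      (h2 : IsDPath X (γ.comp secondHalf)) : IsDPath X γ

/-- The geometric realization as a directed space. -/
def realizationDStructure (X : PrecubicalSet.{u}) : DStructure X.Realization where
  paths := {γ | X.IsDPath γ}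
  const_mem p := by
    induction p using Quot.ind with
    | mk p => exact IsDPath.cell p.1.2 (ContinuousMap.const I p.2) fun _ _ _ => le_rfl
  reparam_mem γ hγ ρ hρ := IsDPath.reparam γ hγ ρ hρ
  concat_mem γ h1 h2 := IsDPath.concat γ h1 h2

end PrecubicalSet

/-! ### Euclidean cubical complexes -/

/-- An elementary cube in `ℝ^N`: a product of `N` intervals with integral endpoints and length
`0` or `1`. -/
def IsElementaryCube {N : ℕ} (S : Set (EuclideanSpace ℝ (Fin N))) : Prop :=
  ∃ a b : Fin N → ℤ, (∀ i, b i - a i = 0 ∨ b i - a i = 1) ∧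
    S = {y | ∀ i, (a i : ℝ) ≤ y i ∧ y i ≤ (b i : ℝ)}

/-- A Euclidean cubical complex: a finite union of elementary cubes. -/
def IsEuclideanCubicalComplex {N : ℕ} (C : Set (EuclideanSpace ℝ (Fin N))) : Prop :=
  ∃ F : Set (Set (EuclideanSpace ℝ (Fin N))),
    F.Finite ∧ (∀ S ∈ F, IsElementaryCube S) ∧ C = ⋃₀ F

/-- A d-isometry of the geometric realization of `X` onto a subset `C` of `ℝ^N`: an isomorphism of
directed spaces that preserves Euclidean distances on every cube of `X` and the order of the
directions of every cube of `X`. -/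
structure PrecubicalSet.IsDIsometry (X : PrecubicalSet.{u}) {N : ℕ}
    (C : Set (EuclideanSpace ℝ (Fin N))) (h : X.Realization ≃ₜ C) : Prop where
  directed : X.realizationDStructure.IsDirected (subsetDStructure C) h
  directed_symm : (subsetDStructure C).IsDirected X.realizationDStructure h.symm
  isometric : ∀ {n : ℕ} (x : X.cell n) (p q : Fin n → I),
    dist (h (X.cellMap x p)) (h (X.cellMap x q)) = √(∑ k, ((p k : ℝ) - (q k : ℝ)) ^ 2)
  /-- If `j < k`, then every axis `a` of `ℝ^N` along which the image moves when only coordinate `j`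
  of a point of the cube is changed precedes every axis `b` along which it moves when only
  coordinate `k` is changed. -/
  order_directions : ∀ {n : ℕ} (x : X.cell n) (j k : Fin n), j < k →
    ∀ p p' q q' : Fin n → I, (∀ i, i ≠ j → p i = p' i) → (∀ i, i ≠ k → q i = q' i) →
    ∀ a b : Fin N,
      (h (X.cellMap x p) : EuclideanSpace ℝ (Fin N)) a ≠
        (h (X.cellMap x p') : EuclideanSpace ℝ (Fin N)) a →
      (h (X.cellMap x q) : EuclideanSpace ℝ (Fin N)) b ≠
        (h (X.cellMap x q') : EuclideanSpace ℝ (Fin N)) b → a < b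

/-- A precubical set is Euclidean if its geometric realization is d-isometric to a Euclidean
cubical complex. -/
def PrecubicalSet.IsEuclidean (X : PrecubicalSet.{u}) : Prop :=
  ∃ (N : ℕ) (C : Set (EuclideanSpace ℝ (Fin N))), IsEuclideanCubicalComplex C ∧
    ∃ h : X.Realization ≃ₜ C, X.IsDIsometry C h

namespace PrecubicalSet

/-! ### Points of the realization and their carriers -/

/-! From a sculpture to Euclidean space: an embedding into the $d$-dimensional bulk turns each cell
into a face of $[0,1]^d$, and these maps glue to a map `Hom.realize` on $|X|$. Removing endpoint
coordinates is a confluent reduction, so each point of $|X|$ has exactly one representative in the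
interior of a cube. The image point determines that representative, hence the map is injective, and
by compactness a homeomorphism onto its image. Its inverse is directed because along a nondecreasing
path each coordinate leaves $0$ once and reaches $1$ once: between these finitely many times the
path stays in one closed cube.

From Euclidean space to a sculpture: a complex is compact, and the cell centres form a closed
discrete set, so $X$ has finitely many cells. An isometry of a cube is affine with orthonormal
directions; directedness makes these nonnegative, and the order condition makes their supports
disjoint and ordered. The integral structure of the complex then enters through one local argument
(`exists_dir_eq_single`): if the complex continues from an interior point of a cube along an axis,
that cube is a face of a cube having this axis as a direction. At a point with an irrational
coordinate this shows that every direction is a coordinate vector; at a non-integral vertex it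
yields a lower one, so vertices are integral.

The cells are now cubes of a bounded integer grid. The bulk receives one coordinate for each unit
interval on each axis, and its value records whether a cube lies before, across or beyond that
interval.

For a connected automaton, a coordinate that is $1$ initially is $1$ on every cell, so it can be
changed to $0$ everywhere. -/

theorem endpoint_injective : Function.Injective endpoint := by
  intro a b h
  cases a <;> cases b <;> simp_all [endpoint]

variable (X : PrecubicalSet.{u})

theorem glue_removeNth {n : ℕ} (x : X.cell (n + 1)) (p : Fin (n + 1) → I) (α : Bool)
    (i : Fin (n + 1)) (h : p i = endpoint α) :
    X.Glue ⟨⟨n, X.face α i x⟩, i.removeNth p⟩ ⟨⟨n + 1, x⟩, p⟩ := by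
  have := Glue.face α i x (i.removeNth p)
  rwa [← h, Fin.insertNth_self_removeNth] at this

theorem exists_of_glue {n : ℕ} (x : X.cell (n + 1)) (p : Fin (n + 1) → I) (c : X.Cubes)
    (h : X.Glue c ⟨⟨n + 1, x⟩, p⟩) :
    ∃ (α : Bool) (i : Fin (n + 1)), p i = endpoint α ∧
      c = ⟨⟨n, X.face α i x⟩, i.removeNth p⟩ := by
  cases h with
  | face α i x p => exact ⟨α, i, by simp, by simp⟩

theorem removeNth_removeNth {n : ℕ} {A : Type*} (p : Fin (n + 2) → A) (i j : Fin (n + 1))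
    (hij : i ≤ j) :
    i.removeNth (j.succ.removeNth p) = j.removeNth (i.castSucc.removeNth p) := by
  funext k
  simp only [Fin.removeNth]
  congr 1
  simp only [Fin.succAbove, Fin.lt_def, Fin.le_def, Fin.ext_iff] at *
  split_ifs <;> simp_all <;> omega

/-- The precubical identity for cells matches `removeNth_removeNth` for coordinates, so two faces
taken in either order end in the same point of the same cube. -/
theorem exists_glue_glue {n : ℕ} (x : X.cell (n + 2)) (p : Fin (n + 2) → I) (α β : Bool)
    (i j : Fin (n + 1)) (hij : i ≤ j) (hi : p i.castSucc = endpoint α)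
    (hj : p j.succ = endpoint β) :
    ∃ d : X.Cubes, X.Glue d ⟨⟨n + 1, X.face β j.succ x⟩, j.succ.removeNth p⟩ ∧
      X.Glue d ⟨⟨n + 1, X.face α i.castSucc x⟩, i.castSucc.removeNth p⟩ := by
  have h1 : j.succ.succAbove i = i.castSucc :=
    Fin.succAbove_of_castSucc_lt _ _ (Fin.castSucc_lt_succ_iff.2 hij)
  have h2 : i.castSucc.succAbove j = j.succ :=
    Fin.succAbove_of_le_castSucc _ _ (Fin.castSucc_le_castSucc_iff.2 hij)
  refine ⟨_, X.glue_removeNth (X.face β j.succ x) (j.succ.removeNth p) α i ?_, ?_⟩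
  · simp [Fin.removeNth, h1, hi]
  · rw [X.face_face α β i j hij, removeNth_removeNth p i j hij]
    exact X.glue_removeNth _ _ β j (by simp [Fin.removeNth, h2, hj])

/-- Passing from a point in the boundary of a cube to the same point of a face. -/
def Reduces (a b : X.Cubes) : Prop := X.Glue b a

/-- Two endpoint coordinates can be removed in either order. The asymmetric conclusion is the
hypothesis of the Church–Rosser theorem. -/
theorem reduces_diamond (a b c : X.Cubes) (hb : X.Reduces a b) (hc : X.Reduces a c) :
    ∃ d, Relation.ReflGen X.Reduces b d ∧ Relation.ReflTransGen X.Reduces c d := by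
  obtain ⟨⟨n, x⟩, p⟩ := a
  cases n with
  | zero => nomatch hb
  | succ n =>
    obtain ⟨α, i, hi, rfl⟩ := X.exists_of_glue x p b hb
    obtain ⟨β, j, hj, rfl⟩ := X.exists_of_glue x p c hc
    rcases lt_trichotomy i j with hij | rfl | hij
    · cases n with
      | zero => exact absurd hij (by omega)
      | succ n =>
        obtain ⟨i, rfl⟩ := Fin.exists_castSucc_eq.2 (hij.trans_le (Fin.le_last j)).ne
        obtain ⟨j, rfl⟩ := Fin.exists_succ_eq.2 (bot_le.trans_lt hij).ne'
        obtain ⟨d, h1, h2⟩ := X.exists_glue_glue x p α β i j (Fin.castSucc_lt_succ_iff.1 hij) hi hj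
        exact ⟨d, .single h2, .single h1⟩
    · obtain rfl : α = β := endpoint_injective (hi.symm.trans hj)
      exact ⟨_, .refl, .refl⟩
    · cases n with
      | zero => exact absurd hij (by omega)
      | succ n =>
        obtain ⟨j, rfl⟩ := Fin.exists_castSucc_eq.2 (hij.trans_le (Fin.le_last i)).ne
        obtain ⟨i, rfl⟩ := Fin.exists_succ_eq.2 (bot_le.trans_lt hij).ne'
        obtain ⟨d, h1, h2⟩ := X.exists_glue_glue x p β α j i (Fin.castSucc_lt_succ_iff.1 hij) hj hi
        exact ⟨d, .single h1, .single h2⟩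

/-! ### Normal forms: unique interior representatives -/

variable {X}

theorem cellMap_eq_of_reduces {a b : X.Cubes} (h : Relation.ReflTransGen X.Reduces a b) :
    X.cellMap a.1.2 a.2 = X.cellMap b.1.2 b.2 := by
  induction h with
  | refl => rfl
  | tail _ h ih => exact ih.trans (Quot.sound (r := X.Glue) h).symm

/-- By Church–Rosser, joinability is an equivalence relation; it contains the gluing relation, hence
also the equivalence generated by it. -/
theorem join_of_cellMap_eq {n m : ℕ} {x : X.cell n} {y : X.cell m} {p : Fin n → I} {q : Fin m → I}
    (h : X.cellMap x p = X.cellMap y q) :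
    Relation.Join (Relation.ReflTransGen X.Reduces) ⟨⟨n, x⟩, p⟩ ⟨⟨m, y⟩, q⟩ := by
  have he := Relation.equivalence_join_reflTransGen X.reduces_diamond
  refine Relation.EqvGen.rec (motive := fun a b _ => Relation.Join _ a b) ?_ ?_ ?_ ?_
    (Quot.eqvGen_exact h)
  · exact fun a b hab => ⟨a, .refl, .single hab⟩
  · exact he.refl
  · exact fun _ _ _ => he.symm
  · exact fun _ _ _ _ _ => he.trans

/-- A point in the interior of a cube. -/
def IsInterior {n : ℕ} (p : Fin n → I) : Prop := ∀ k, 0 < p k ∧ p k < 1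

theorem IsInterior.eq_of_reduces {n : ℕ} {x : X.cell n} {p : Fin n → I} (hp : IsInterior p)
    {b : X.Cubes} (h : Relation.ReflTransGen X.Reduces ⟨⟨n, x⟩, p⟩ b) : b = ⟨⟨n, x⟩, p⟩ := by
  rcases h.cases_head with h | ⟨c, h, -⟩
  · exact h.symm
  · cases n with
    | zero => nomatch h
    | succ n =>
      obtain ⟨α, i, hi, -⟩ := X.exists_of_glue x p c h
      have := hp i
      rw [hi] at this
      cases α <;> simp [endpoint] at this

/-- A point of the realization has only one representative in the interior of a cube, and all other
representatives are reduced to it by taking faces. -/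
theorem IsInterior.reduces {n m : ℕ} {x : X.cell n} {y : X.cell m} {p : Fin n → I} {q : Fin m → I}
    (hq : IsInterior q) (h : X.cellMap x p = X.cellMap y q) :
    Relation.ReflTransGen X.Reduces ⟨⟨n, x⟩, p⟩ ⟨⟨m, y⟩, q⟩ := by
  obtain ⟨d, h1, h2⟩ := join_of_cellMap_eq h
  rwa [hq.eq_of_reduces h2] at h1

theorem IsInterior.eq {n m : ℕ} {x : X.cell n} {y : X.cell m} {p : Fin n → I} {q : Fin m → I}
    (hp : IsInterior p) (hq : IsInterior q) (h : X.cellMap x p = X.cellMap y q) :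
    (⟨⟨m, y⟩, q⟩ : X.Cubes) = ⟨⟨n, x⟩, p⟩ :=
  hp.eq_of_reduces (hq.reduces h)

/-- Endpoint coordinates are removed until none is left. The last clause records that nothing new
appears, so a point with only endpoint coordinates must reduce to dimension $0$. -/
theorem exists_isInterior {n : ℕ} (x : X.cell n) (p : Fin n → I) :
    ∃ (m : ℕ) (y : X.cell m) (q : Fin m → I), IsInterior q ∧
      Relation.ReflTransGen X.Reduces ⟨⟨n, x⟩, p⟩ ⟨⟨m, y⟩, q⟩ ∧
      ∀ k, ∃ j, q k = p j := by
  induction n with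
  | zero => exact ⟨0, x, p, fun k => k.elim0, .refl, fun k => ⟨k, rfl⟩⟩
  | succ n ih =>
    by_cases hp : IsInterior p
    · exact ⟨_, x, p, hp, .refl, fun k => ⟨k, rfl⟩⟩
    · obtain ⟨i, α, hi⟩ : ∃ i α, p i = endpoint α := by
        simp only [IsInterior, not_forall, not_and_or, not_lt] at hp
        obtain ⟨i, h | h⟩ := hp
        · exact ⟨i, false, by simpa [endpoint] using h⟩
        · exact ⟨i, true, le_antisymm unitInterval.le_one' h⟩
      obtain ⟨m, y, q, hq, hr, h⟩ := ih (X.face α i x) (i.removeNth p)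
      refine ⟨m, y, q, hq, .head (X.glue_removeNth x p α i hi) hr, fun k => ?_⟩
      obtain ⟨j, hj⟩ := h k
      exact ⟨_, hj⟩

theorem exists_cellMap_eq_isInterior (z : X.Realization) :
    ∃ (m : ℕ) (y : X.cell m) (q : Fin m → I), IsInterior q ∧ X.cellMap y q = z := by
  induction z using Quot.ind with
  | mk a =>
    obtain ⟨m, y, q, hq, h, -⟩ := exists_isInterior a.1.2 a.2
    exact ⟨m, y, q, hq, (cellMap_eq_of_reduces h).symm⟩

/-- A representative of a vertex of the realization is a vertex of its cube. -/
theorem eq_endpoint_of_reduces {n : ℕ} {x : X.cell n} {p : Fin n → I} {v : X.cell 0}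
    {q : Fin 0 → I} (h : Relation.ReflTransGen X.Reduces ⟨⟨n, x⟩, p⟩ ⟨⟨0, v⟩, q⟩) (k : Fin n) :
    p k = 0 ∨ p k = 1 := by
  induction n with
  | zero => exact k.elim0
  | succ n ih =>
    rcases h.cases_head with h | ⟨c, h, h'⟩
    · simp only [Sigma.mk.injEq] at h
      exact absurd h.1.1 (by simp)
    · obtain ⟨α, i, hi, rfl⟩ := X.exists_of_glue x p c h
      rcases Fin.eq_self_or_eq_succAbove i k with rfl | ⟨k, rfl⟩
      · rw [hi]
        cases α <;> simp [endpoint]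
      · exact ih h' k

theorem exists_vertex {n : ℕ} (x : X.cell n) (p : Fin n → I) (hp : ∀ k, p k = 0 ∨ p k = 1) :
    ∃ v : X.cell 0, X.cellMap x p = X.cellMap v ![] := by
  obtain ⟨m, y, q, hq, hr, h⟩ := exists_isInterior x p
  cases m with
  | zero =>
    refine ⟨y, (cellMap_eq_of_reduces hr).trans ?_⟩
    rw [Subsingleton.elim q ![]]
  | succ m =>
    obtain ⟨j, hj⟩ := h 0
    have := hq 0
    rw [hj] at this
    rcases hp j with h | h <;> simp [h] at this

/-! ### Finiteness -/

/-- The midpoint of a cube. -/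
noncomputable def midpoint (n : ℕ) : Fin n → I := fun _ => ⟨1 / 2, by norm_num, by norm_num⟩

theorem isInterior_midpoint (n : ℕ) : IsInterior (midpoint n) := fun k => by
  constructor
  · exact Subtype.mk_lt_mk.2 (by norm_num)
  · exact Subtype.mk_lt_mk.2 (by norm_num)

/-- The barycentre of a cell. -/
noncomputable def center (X : PrecubicalSet.{u}) (x : Σ n, X.cell n) : X.Realization :=
  X.cellMap x.2 (midpoint x.1)

theorem center_injective : Function.Injective X.center := fun x y h => by
  have := IsInterior.eq (isInterior_midpoint _) (isInterior_midpoint _) h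
  exact (congrArg Sigma.fst this).symm

/-- A reduction drops only endpoint coordinates, and those that survive are all $1/2$. Hence each
cube contains only finitely many representatives of centres. -/
theorem eq_of_reduces_center {n : ℕ} {x : X.cell n} {p : Fin n → I} {y : Σ n, X.cell n}
    (h : Relation.ReflTransGen X.Reduces ⟨⟨n, x⟩, p⟩ ⟨y, midpoint y.1⟩) (k : Fin n) :
    p k = 0 ∨ p k = 1 ∨ p k = ⟨1 / 2, by norm_num, by norm_num⟩ := by
  induction n with
  | zero => exact k.elim0
  | succ n ih =>
    rcases h.cases_head with h | ⟨c, h, h'⟩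
    · obtain ⟨rfl, h⟩ := Sigma.mk.inj_iff.1 h
      obtain rfl := eq_of_heq h
      exact .inr (.inr rfl)
    · obtain ⟨α, i, hi, rfl⟩ := X.exists_of_glue x p c h
      rcases Fin.eq_self_or_eq_succAbove i k with rfl | ⟨k, rfl⟩
      · rw [hi]
        cases α <;> simp [endpoint]
      · exact ih h' k

theorem isQuotientMap_mk :
    Topology.IsQuotientMap (Y := X.Realization) (Quot.mk X.Glue) :=
  isQuotientMap_quot_mk

theorem isClosed_image_center (S : Set (Σ n, X.cell n)) : IsClosed (X.center '' S) := by
  rw [← isQuotientMap_mk.isClosed_preimage, isClosed_sigma_iff]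
  rintro ⟨n, x⟩
  refine (Set.Finite.subset (Set.Finite.pi' (ι := Fin n)
    (t := fun _ => ({0, 1, ⟨1 / 2, by norm_num, by norm_num⟩} : Set I))
    fun _ => Set.toFinite _) ?_).isClosed
  rintro p ⟨y, -, h⟩ k
  exact eq_of_reduces_center ((isInterior_midpoint _).reduces (x := x) (p := p) h.symm) k

/-- Every set of centres is closed, so the set of all centres is closed and discrete, and therefore
finite in a compact space. -/
theorem finite_cells_of_compactSpace [CompactSpace X.Realization] : Finite (Σ n, X.cell n) := by
  have h : (Set.range X.center).Finite := by
    refine IsCompact.finite ?_ ?_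
    · rw [← Set.image_univ]
      exact (isClosed_image_center _).isCompact
    · rw [isDiscrete_iff_discreteTopology]
      refine discreteTopology_iff_forall_isClosed.2 fun s => ?_
      rw [isClosed_induced_iff]
      refine ⟨X.center '' (X.center ⁻¹' ((↑) '' s)), isClosed_image_center _, ?_⟩
      ext ⟨_, y, rfl⟩
      constructor
      · rintro ⟨z, ⟨w, hw, hwz⟩, hz⟩
        rw [hz] at hwz
        rwa [← Subtype.ext (a1 := w) (a2 := ⟨_, y, rfl⟩) hwz]
      · intro h
        exact ⟨y, ⟨_, h, rfl⟩, rfl⟩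
  exact (Set.finite_range_iff center_injective).1 h

instance [Finite (Σ n, X.cell n)] : CompactSpace X.Realization :=
  inferInstanceAs (CompactSpace (Quot X.Glue))

end PrecubicalSet

/-! ### Directed paths and subdivision -/

/-- The affine path in the unit interval from `s` to `t`. -/
noncomputable def subsegment (s t : I) : C(I, I) where
  toFun r := ⟨(1 - (r : ℝ)) * s + r * t,
    convex_Icc (0 : ℝ) 1 s.2 t.2 (by linarith [r.2.2]) r.2.1 (by ring)⟩
  continuous_toFun := by fun_prop

theorem coe_subsegment (s t r : I) :
    (subsegment s t r : ℝ) = (1 - (r : ℝ)) * s + r * t := rfl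

theorem monotone_subsegment {s t : I} (h : s ≤ t) : Monotone (subsegment s t) := by
  intro a b hab
  have h1 : (s : ℝ) ≤ t := h
  have h2 : (a : ℝ) ≤ b := hab
  exact Subtype.mk_le_mk.2 (by nlinarith)

theorem subsegment_mem_Icc {s t : I} (h : s ≤ t) (r : I) :
    subsegment s t r ∈ Set.Icc s t := by
  have h1 : (s : ℝ) ≤ t := h
  constructor
  · exact Subtype.mk_le_mk.2 (by nlinarith [r.2.1])
  · exact Subtype.mk_le_mk.2 (by nlinarith [r.2.2])

theorem subsegment_zero_one : subsegment 0 1 = ContinuousMap.id I := by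
  ext r
  simp [coe_subsegment]

/-- The path from `s` to `t` that is affine on both halves and passes through `m` halfway. -/
noncomputable def brokenSegment (s m t : I) : C(I, I) where
  toFun r := Set.projIcc 0 1 zero_le_one
    (s + (m - s) * min (2 * (r : ℝ)) 1 + (t - m) * max (2 * (r : ℝ) - 1) 0)
  continuous_toFun := by fun_prop

/-- A reparametrization that takes `brokenSegment s m t` to `subsegment s t`. -/
noncomputable def straighten (s m t : I) : C(I, I) where
  toFun r := Set.projIcc 0 1 zero_le_one
    (min ((subsegment s t r - s) / ((m : ℝ) - s)) 1 / 2 +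
      max ((subsegment s t r - m) / ((t : ℝ) - m)) 0 / 2)
  continuous_toFun := by
    refine continuous_projIcc.comp ?_
    fun_prop

theorem monotone_straighten {s m t : I} (h1 : s < m) (h2 : m < t) :
    Monotone (straighten s m t) := by
  have h1' : (0 : ℝ) < m - s := sub_pos.2 h1
  have h2' : (0 : ℝ) < t - m := sub_pos.2 h2
  intro a b hab
  have h : (subsegment s t a : ℝ) ≤ subsegment s t b :=
    monotone_subsegment (h1.trans h2).le hab
  refine Set.monotone_projIcc (zero_le_one' ℝ) ?_
  gcongr

theorem brokenSegment_firstHalf (s m t : I) :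
    (brokenSegment s m t).comp firstHalf = subsegment s m := by
  ext r
  have h : (s + (m - s) * min (2 * ((r : ℝ) / 2)) 1 + (t - m) * max (2 * ((r : ℝ) / 2) - 1) 0 : ℝ) =
      subsegment s m r := by
    rw [min_eq_left (by linarith [r.2.2]), max_eq_right (by linarith [r.2.2]), coe_subsegment]
    ring
  change (Set.projIcc (0 : ℝ) 1 zero_le_one
    (s + (m - s) * min (2 * ((r : ℝ) / 2)) 1 + (t - m) * max (2 * ((r : ℝ) / 2) - 1) 0 : ℝ) : ℝ) = _
  rw [h, Set.projIcc_val]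

theorem brokenSegment_secondHalf (s m t : I) :
    (brokenSegment s m t).comp secondHalf = subsegment m t := by
  ext r
  have h : (s + (m - s) * min (2 * ((1 + (r : ℝ)) / 2)) 1 +
      (t - m) * max (2 * ((1 + (r : ℝ)) / 2) - 1) 0 : ℝ) = subsegment m t r := by
    rw [min_eq_right (by linarith [r.2.1]), max_eq_left (by linarith [r.2.1]), coe_subsegment]
    ring
  change (Set.projIcc (0 : ℝ) 1 zero_le_one (s + (m - s) * min (2 * ((1 + (r : ℝ)) / 2)) 1 +
      (t - m) * max (2 * ((1 + (r : ℝ)) / 2) - 1) 0 : ℝ) : ℝ) = _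
  rw [h, Set.projIcc_val]

theorem brokenSegment_straighten {s m t : I} (h1 : s < m) (h2 : m < t) :
    (brokenSegment s m t).comp (straighten s m t) = subsegment s t := by
  have h1' : (0 : ℝ) < m - s := sub_pos.2 h1
  have h2' : (0 : ℝ) < t - m := sub_pos.2 h2
  ext r
  set z := subsegment s t r with hz
  obtain ⟨hs, ht⟩ := subsegment_mem_Icc (h1.trans h2).le r
  have hs' : (0 : ℝ) ≤ z - s := sub_nonneg.2 hs
  have ht' : (0 : ℝ) ≤ t - z := sub_nonneg.2 ht
  change (Set.projIcc (0 : ℝ) 1 zero_le_one (s + (m - s) * min (2 * (straighten s m t r : ℝ)) 1 +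
      (t - m) * max (2 * (straighten s m t r : ℝ) - 1) 0 : ℝ) : ℝ) = _
  have hst : (straighten s m t r : ℝ) = Set.projIcc 0 1 zero_le_one
    (min ((z - s) / ((m : ℝ) - s)) 1 / 2 + max ((z - m) / ((t : ℝ) - m)) 0 / 2) := rfl
  suffices h : (s + (m - s) * min (2 * (straighten s m t r : ℝ)) 1 +
      (t - m) * max (2 * (straighten s m t r : ℝ) - 1) 0 : ℝ) = z by
    rw [h, Set.projIcc_val]
  rcases le_total (z : ℝ) m with h | h
  · have ha : (z - s) / ((m : ℝ) - s) ≤ 1 := (div_le_one h1').2 (by linarith)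
    have ha0 : 0 ≤ (z - s) / ((m : ℝ) - s) := by positivity
    have hb : (z - m) / ((t : ℝ) - m) ≤ 0 := div_nonpos_of_nonpos_of_nonneg (by linarith) h2'.le
    rw [min_eq_left ha, max_eq_right hb, Set.projIcc_of_mem _ (by constructor <;> linarith)] at hst
    rw [hst, min_eq_left (by dsimp only; linarith), max_eq_right (by dsimp only; linarith)]
    field_simp
    ring
  · have ha : 1 ≤ (z - s) / ((m : ℝ) - s) := (one_le_div h1').2 (by linarith)
    have hb : 0 ≤ (z - m) / ((t : ℝ) - m) := div_nonneg (by linarith) h2'.le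
    have hb1 : (z - m) / ((t : ℝ) - m) ≤ 1 := (div_le_one h2').2 (by linarith)
    rw [min_eq_right ha, max_eq_left hb, Set.projIcc_of_mem _ (by constructor <;> linarith)] at hst
    rw [hst, min_eq_right (by dsimp only; linarith), max_eq_left (by dsimp only; linarith)]
    field_simp
    ring

/-- Concatenation is available only at time $1/2$. The path is first run so that it passes $m$ at
that time, and `straighten` then restores the affine speed. -/
theorem DStructure.segment_trans {Y : Type u} [TopologicalSpace Y] (P : DStructure Y) (γ : C(I, Y))
    {s m t : I} (h1 : s < m) (h2 : m < t) (hsm : γ.comp (subsegment s m) ∈ P.paths)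
    (hmt : γ.comp (subsegment m t) ∈ P.paths) : γ.comp (subsegment s t) ∈ P.paths := by
  rw [← brokenSegment_straighten h1 h2, ← ContinuousMap.comp_assoc]
  refine P.reparam_mem _ (P.concat_mem _ ?_ ?_) _ (monotone_straighten h1 h2)
  · rwa [ContinuousMap.comp_assoc, brokenSegment_firstHalf]
  · rwa [ContinuousMap.comp_assoc, brokenSegment_secondHalf]

/-- A path is directed if it is so between any two successive members of a finite set of times. -/
theorem DStructure.mem_of_segments {Y : Type u} [TopologicalSpace Y] (P : DStructure Y)
    (γ : C(I, Y)) (T : Finset I)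
    (hT : ∀ s t : I, s < t → (∀ r ∈ T, r ∉ Set.Ioo s t) → γ.comp (subsegment s t) ∈ P.paths) :
    γ ∈ P.paths := by
  classical
  suffices h : ∀ (n : ℕ) (s t : I), s < t → (T.filter (· ∈ Set.Ioo s t)).card = n →
      γ.comp (subsegment s t) ∈ P.paths by
    simpa [subsegment_zero_one] using h _ 0 1 zero_lt_one rfl
  intro n
  -- Cutting at a member of `T` strictly between `s` and `t` removes that member from both open
  -- subintervals.
  induction n using Nat.strong_induction_on with
  | _ n ih =>
    rintro s t hst rfl
    by_cases h : ∀ r ∈ T, r ∉ Set.Ioo s t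
    · exact hT s t hst h
    · push Not at h
      obtain ⟨m, hm, hsm, hmt⟩ := h
      refine P.segment_trans γ hsm hmt (ih _ (Finset.card_lt_card ?_) s m hsm rfl)
        (ih _ (Finset.card_lt_card ?_) m t hmt rfl)
      · refine (Finset.ssubset_iff_of_subset fun r => ?_).2 ⟨m, ?_, ?_⟩
        · simp only [Finset.mem_filter, Set.mem_Ioo]
          exact fun h => ⟨h.1, h.2.1, h.2.2.trans hmt⟩
        · simp [hm, hsm, hmt]
        · simp
      · refine (Finset.ssubset_iff_of_subset fun r => ?_).2 ⟨m, ?_, ?_⟩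
        · simp only [Finset.mem_filter, Set.mem_Ioo]
          exact fun h => ⟨h.1, hsm.trans h.2.1, h.2.2⟩
        · simp [hm, hsm, hmt]
        · simp

/-- A monotone property of times holds from some time on and not before. -/
theorem exists_switch {p : I → Prop} (hp : ∀ r r', r ≤ r' → p r → p r') :
    ∃ c : I, ∀ s t : I, c ∉ Set.Ioo s t → ∀ r ∈ Set.Ioo s t, ∀ r' ∈ Set.Ioo s t, p r → p r' := by
  -- Whether `p` holds at the infimum itself is left open, which is why the intervals are open. If
  -- `p` never holds, the infimum is $1$.
  refine ⟨sInf {r | p r}, fun s t h r hr r' hr' hpr => ?_⟩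
  simp only [Set.mem_Ioo, not_and_or, not_lt] at h
  rcases h with h | h
  · obtain ⟨a, ha, har⟩ := sInf_lt_iff.1 (h.trans_lt hr'.1)
    exact hp _ _ har.le ha
  · exact absurd hr.2 (h.trans (sInf_le hpr)).not_gt

/-! ### The cubes of the bulk as subsets of Euclidean space -/

namespace BulkCell

variable {d n : ℕ}

/-- The point with coordinates `p` of the cube of a cell of the bulk. -/
noncomputable def point (c : BulkCell d n) (p : Fin n → I) : EuclideanSpace ℝ (Fin d) :=
  WithLp.toLp 2 fun i =>
    (if c.1 i = some true then 1 else 0) + ∑ k, if c.position k = i then (p k : ℝ) else 0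

theorem position_strictMono (c : BulkCell d n) : StrictMono c.position :=
  ((executing c.1).orderEmbOfFin c.2).strictMono

theorem apply_position (c : BulkCell d n) (k : Fin n) : c.1 (c.position k) = none := by
  simpa [executing] using c.position_mem k

theorem exists_position (c : BulkCell d n) {i : Fin d} (h : c.1 i = none) :
    ∃ k, c.position k = i := by
  have : i ∈ Set.range ((executing c.1).orderEmbOfFin c.2) := by
    rw [Finset.range_orderEmbOfFin]
    simpa [executing] using h
  exact this

theorem point_position (c : BulkCell d n) (p : Fin n → I) (k : Fin n) :
    c.point p (c.position k) = p k := by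
  simp [point, c.apply_position, c.position_strictMono.injective.eq_iff]

theorem point_of_eq_some (c : BulkCell d n) (p : Fin n → I) {i : Fin d} {b : Bool}
    (h : c.1 i = some b) : c.point p i = endpoint b := by
  have h' : ∀ k, c.position k ≠ i := by
    rintro k rfl
    simp [c.apply_position] at h
  cases b <;> simp [point, h, h', endpoint]

theorem point_ext (c : BulkCell d n) (p : Fin n → I) (y : EuclideanSpace ℝ (Fin d))
    (h1 : ∀ k, y (c.position k) = p k) (h2 : ∀ i b, c.1 i = some b → y i = endpoint b) :
    y = c.point p := by
  ext i
  cases h : c.1 i with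
  | none =>
    obtain ⟨k, rfl⟩ := c.exists_position h
    rw [h1, point_position]
  | some b => rw [h2 i b h, c.point_of_eq_some p h]

theorem point_face (c : BulkCell d (n + 1)) (α : Bool) (i : Fin (n + 1)) (p : Fin n → I) :
    (c.face α i).point p = c.point (i.insertNth (endpoint α) p) := by
  have hi : (c.face α i).1 (c.position i) = some α := Function.update_self ..
  refine c.point_ext _ _ (fun k => ?_) fun j b hj => ?_
  · rcases Fin.eq_self_or_eq_succAbove i k with rfl | ⟨k, rfl⟩
    · rw [point_of_eq_some _ _ hi, Fin.insertNth_apply_same]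
    · rw [← position_face α i c k, point_position, Fin.insertNth_apply_succAbove]
  · refine point_of_eq_some _ _ ?_
    change Function.update c.1 (c.position i) (some α) j = _
    rw [Function.update_of_ne, hj]
    rintro rfl
    simp [c.apply_position] at hj

theorem continuous_point (c : BulkCell d n) : Continuous c.point := by
  refine (PiLp.continuous_toLp 2 _).comp (continuous_pi fun i => ?_)
  refine continuous_const.add (continuous_finsetSum _ fun k _ => ?_)
  split_ifs
  · fun_prop
  · fun_prop

theorem dist_point (c : BulkCell d n) (p q : Fin n → I) :
    dist (c.point p) (c.point q) = √(∑ k, ((p k : ℝ) - (q k : ℝ)) ^ 2) := by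
  rw [EuclideanSpace.dist_eq]
  congr 1
  rw [← Finset.sum_subset (Finset.subset_univ (executing c.1)),
    ← Finset.map_orderEmbOfFin_univ (executing c.1) c.2, Finset.sum_map]
  · refine Finset.sum_congr rfl fun k _ => ?_
    change dist (c.point p (c.position k)) (c.point q (c.position k)) ^ 2 = _
    rw [point_position, point_position, Real.dist_eq, sq_abs]
  · intro i _ hi
    cases h : c.1 i with
    | none => simp [executing, h] at hi
    | some b => simp [c.point_of_eq_some _ h]

theorem point_mem (c : BulkCell d n) (p : Fin n → I) (i : Fin d) : c.point p i ∈ I := by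
  cases h : c.1 i with
  | none =>
    obtain ⟨k, rfl⟩ := c.exists_position h
    rw [point_position]
    exact (p k).2
  | some b =>
    rw [c.point_of_eq_some _ h]
    exact (endpoint b).2

theorem eq_position_of_point_ne (c : BulkCell d n) {j : Fin n} {p p' : Fin n → I}
    (hp : ∀ i, i ≠ j → p i = p' i) {a : Fin d} (ha : c.point p a ≠ c.point p' a) :
    a = c.position j := by
  cases h : c.1 a with
  | none =>
    obtain ⟨k, rfl⟩ := c.exists_position h
    by_contra hne
    rw [point_position, point_position, hp k (by rintro rfl; exact hne rfl)] at ha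
    exact ha rfl
  | some b =>
    rw [c.point_of_eq_some _ h, c.point_of_eq_some _ h] at ha
    exact absurd rfl ha

theorem monotone_point (c : BulkCell d n) (i : Fin d) : Monotone fun p => c.point p i := by
  intro p q hpq
  cases h : c.1 i with
  | none =>
    obtain ⟨k, rfl⟩ := c.exists_position h
    simpa [point_position] using hpq k
  | some b => simp [c.point_of_eq_some _ h]

/-- The tuple of a cell is determined by an interior point of its cube. -/
theorem eq_none_iff (c : BulkCell d n) {p : Fin n → I} (hp : PrecubicalSet.IsInterior p)
    (i : Fin d) : c.1 i = none ↔ c.point p i ≠ 0 ∧ c.point p i ≠ 1 := by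
  cases h : c.1 i with
  | none =>
    obtain ⟨k, rfl⟩ := c.exists_position h
    have := hp k
    rw [point_position]
    refine iff_of_true rfl ⟨?_, ?_⟩
    · simpa using this.1.ne'
    · simpa using this.2.ne
  | some b => cases b <;> simp [c.point_of_eq_some _ h, endpoint]

theorem eq_of_point_eq {m : ℕ} (c : BulkCell d n) (c' : BulkCell d m) {p : Fin n → I}
    {q : Fin m → I} (hp : PrecubicalSet.IsInterior p) (hq : PrecubicalSet.IsInterior q)
    (h : c.point p = c'.point q) : c.1 = c'.1 := by
  funext i
  have h1 := (c.eq_none_iff hp i).trans ((c'.eq_none_iff hq i).trans (by rw [h])).symm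
  cases hc : c.1 i with
  | none => exact (h1.1 hc).symm
  | some b =>
    cases hc' : c'.1 i with
    | none => simp [h1.2 hc'] at hc
    | some b' =>
      have h2 := c.point_of_eq_some p hc
      rw [h, c'.point_of_eq_some q hc'] at h2
      rw [PrecubicalSet.endpoint_injective (Subtype.ext h2)]

theorem isElementaryCube_range_point (c : BulkCell d n) :
    IsElementaryCube (Set.range c.point) := by
  refine ⟨fun i => if c.1 i = some true then 1 else 0,
    fun i => if c.1 i = some false then 0 else 1, fun i => ?_, ?_⟩
  · rcases h : c.1 i with _ | _ | _ <;> simp [h]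
  · ext y
    constructor
    · rintro ⟨p, rfl⟩ i
      rcases h : c.1 i with _ | _ | _
      · obtain ⟨k, rfl⟩ := c.exists_position h
        simpa [h, point_position] using ⟨(p k).2.1, (p k).2.2⟩
      · simp [h, c.point_of_eq_some p h, endpoint]
      · simp [h, c.point_of_eq_some p h, endpoint]
    · intro hy
      refine ⟨fun k => ⟨y (c.position k), by simpa [c.apply_position] using hy (c.position k)⟩,
        (c.point_ext _ _ (fun k => rfl) fun i b h => ?_).symm⟩
      have := hy i
      cases b
      · simp [h] at this
        simpa [endpoint] using le_antisymm this.2 this.1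
      · simp [h] at this
        simpa [endpoint] using le_antisymm this.2 this.1

end BulkCell

/-! ### Sculptures are Euclidean -/

namespace PrecubicalSet

variable {X : PrecubicalSet.{u}} {d : ℕ}

/-- The image of a cell under a morphism to a bulk. -/
def Hom.tuple (f : Hom X (bulk d)) {n : ℕ} (x : X.cell n) : BulkCell d n := f.app n x

theorem Hom.tuple_face (f : Hom X (bulk d)) {n : ℕ} (α : Bool) (i : Fin (n + 1))
    (x : X.cell (n + 1)) : f.tuple (X.face α i x) = (f.tuple x).face α i :=
  f.app_face α i x

/-- The map of the realization to Euclidean space that is induced by a morphism to a bulk. -/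
noncomputable def Hom.realize (f : Hom X (bulk d)) : X.Realization → EuclideanSpace ℝ (Fin d) :=
  Quot.lift (fun a => (f.tuple a.1.2).point a.2) (by
    rintro _ _ ⟨α, i, x, p⟩
    change (f.tuple (X.face α i x)).point p = _
    rw [f.tuple_face]
    exact (f.tuple x).point_face α i p)

theorem Hom.realize_cellMap (f : Hom X (bulk d)) {n : ℕ} (x : X.cell n) (p : Fin n → I) :
    f.realize (X.cellMap x p) = (f.tuple x).point p := rfl

theorem Hom.continuous_realize (f : Hom X (bulk d)) : Continuous f.realize := by
  rw [isQuotientMap_mk.continuous_iff, continuous_sigma_iff]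
  exact fun x => (f.tuple x.2).continuous_point

/-- The dimension can be read off a tuple as its number of executing entries, so injectivity in each
dimension is enough. -/
theorem Hom.IsEmbedding.sigma_injective {f : Hom X (bulk d)} (hf : f.IsEmbedding) :
    Function.Injective fun x : Σ n, X.cell n => (f.tuple x.2).1 := by
  rintro ⟨n, x⟩ ⟨m, y⟩ h
  obtain rfl : n = m := (f.tuple x).2.symm.trans ((congrArg (fun c => (executing c).card) h).trans
    (f.tuple y).2)
  exact congrArg _ (hf n (Subtype.ext h))

theorem Hom.IsEmbedding.finite {f : Hom X (bulk d)} (hf : f.IsEmbedding) :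
    Finite (Σ n, X.cell n) :=
  Finite.of_injective _ hf.sigma_injective

/-- For interior representatives, the coordinates other than $0$ and $1$ mark the executing entries,
so the image point determines the tuple, hence the cell, and then the coordinates in its cube. -/
theorem Hom.IsEmbedding.realize_injective {f : Hom X (bulk d)} (hf : f.IsEmbedding) :
    Function.Injective f.realize := by
  intro z w h
  obtain ⟨n, x, p, hp, rfl⟩ := exists_cellMap_eq_isInterior z
  obtain ⟨m, y, q, hq, rfl⟩ := exists_cellMap_eq_isInterior w
  have h' := hf.sigma_injective (a₁ := ⟨n, x⟩) (a₂ := ⟨m, y⟩) (BulkCell.eq_of_point_eq _ _ hp hq h)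
  obtain ⟨rfl, h'⟩ := Sigma.mk.inj_iff.1 h'
  obtain rfl := eq_of_heq h'
  congr 1
  funext k
  apply Subtype.ext
  rw [← (f.tuple x).point_position p k, ← (f.tuple x).point_position q k]
  exact congrArg (fun y : EuclideanSpace ℝ (Fin d) => y ((f.tuple x).position k)) h

/-- The homeomorphism of the realization onto its image in Euclidean space. -/
noncomputable def Hom.IsEmbedding.homeo {f : Hom X (bulk d)} (hf : f.IsEmbedding) :
    X.Realization ≃ₜ Set.range f.realize :=
  -- Finitely many cells make the realization compact, and a continuous bijection from a compact
  -- space onto a Hausdorff space is a homeomorphism.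
  haveI := hf.finite
  Continuous.homeoOfEquivCompactToT2 (f := Equiv.ofInjective f.realize hf.realize_injective)
    (f.continuous_realize.subtype_mk _)

theorem Hom.IsEmbedding.coe_homeo {f : Hom X (bulk d)} (hf : f.IsEmbedding) (z : X.Realization) :
    (hf.homeo z : EuclideanSpace ℝ (Fin d)) = f.realize z := rfl

theorem isEuclideanCubicalComplex_range {f : Hom X (bulk d)} (hf : f.IsEmbedding) :
    IsEuclideanCubicalComplex (Set.range f.realize) := by
  have := hf.finite
  refine ⟨Set.range fun x : Σ n, X.cell n => Set.range ((f.tuple x.2).point),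
    Set.finite_range _, ?_, ?_⟩
  · rintro _ ⟨x, rfl⟩
    exact BulkCell.isElementaryCube_range_point _
  · ext y
    constructor
    · rintro ⟨z, rfl⟩
      obtain ⟨n, x, p, -, rfl⟩ := exists_cellMap_eq_isInterior z
      exact ⟨_, ⟨⟨n, x⟩, rfl⟩, p, rfl⟩
    · rintro ⟨_, ⟨x, rfl⟩, p, rfl⟩
      exact ⟨X.cellMap x.2 p, rfl⟩

theorem Hom.IsEmbedding.isDirected_homeo {f : Hom X (bulk d)} (hf : f.IsEmbedding) :
    X.realizationDStructure.IsDirected (subsetDStructure (Set.range f.realize)) hf.homeo := by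
  intro γ hγ
  induction hγ with
  | cell x γ hγ => exact fun a => ((f.tuple x).monotone_point a).comp hγ
  | reparam γ _ ρ hρ ih => exact (subsetDStructure _).reparam_mem _ ih ρ hρ
  | concat γ _ _ h1 h2 => exact (subsetDStructure _).concat_mem _ h1 h2

/-- A nondecreasing path that does not change its carrier on `Set.Ioo s t` is a path in a cube
there. -/
theorem Hom.IsEmbedding.segment_mem {f : Hom X (bulk d)} (hf : f.IsEmbedding)
    {γ : C(I, Set.range f.realize)} (hγ : γ ∈ (subsetDStructure (Set.range f.realize)).paths)
    {s t : I} (hst : s < t)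
    (h0 : ∀ i, ∀ r ∈ Set.Ioo s t, ∀ r' ∈ Set.Ioo s t, 0 < (γ r).1 i → 0 < (γ r').1 i)
    (h1 : ∀ i, ∀ r ∈ Set.Ioo s t, ∀ r' ∈ Set.Ioo s t, 1 ≤ (γ r).1 i → 1 ≤ (γ r').1 i) :
    X.IsDPath (((hf.homeo.symm : C(Set.range f.realize, X.Realization)).comp γ).comp
      (subsegment s t)) := by
  -- The carrier at an arbitrary intermediate time serves for the whole closed interval.
  obtain ⟨m, hm⟩ := exists_between hst
  obtain ⟨n, x, p, hp, hx⟩ := exists_cellMap_eq_isInterior (hf.homeo.symm (γ m))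
  have hx' : (γ m : EuclideanSpace ℝ (Fin d)) = (f.tuple x).point p := by
    rw [← f.realize_cellMap, hx, ← hf.coe_homeo, Homeomorph.apply_symm_apply]
  have hI : ∀ r i, 0 ≤ (γ r).1 i ∧ (γ r).1 i ≤ 1 := by
    intro r i
    obtain ⟨z, hz⟩ := (γ r).2
    obtain ⟨n, x, p, -, rfl⟩ := exists_cellMap_eq_isInterior z
    rw [← hz, f.realize_cellMap]
    exact (f.tuple x).point_mem p i
  have hcont : ∀ i, Continuous fun r => (γ r).1 i := fun i => by fun_prop
  have hsome : ∀ i b, (f.tuple x).1 i = some b → ∀ r ∈ Set.Icc s t,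
      (γ r).1 i = endpoint b := by
    intro i b hb
    have hmi : (γ m).1 i = endpoint b := by rw [hx', BulkCell.point_of_eq_some _ _ hb]
    -- At the ends the path may lie in a proper face of the cube; there the fixed coordinates are
    -- obtained by continuity.
    rw [← closure_Ioo hst.ne]
    refine closure_minimal (fun r hr => ?_) (isClosed_eq (hcont i) continuous_const)
    cases b
    · simp only [endpoint, Bool.false_eq_true, if_false, Set.Icc.coe_zero] at hmi ⊢
      refine le_antisymm (not_lt.1 fun h => ?_) (hI r i).1
      exact (h0 i r hr m hm h).ne' hmi
    · simp only [endpoint, if_true, Set.Icc.coe_one] at hmi ⊢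
      exact le_antisymm (hI r i).2 (h1 i m hm r hr hmi.ge)
  let δ : C(I, Fin n → I) :=
    { toFun := fun r k => ⟨(γ (subsegment s t r)).1 ((f.tuple x).position k), hI _ _⟩
      continuous_toFun := continuous_pi fun k =>
        ((hcont _).comp (subsegment s t).continuous).subtype_mk _ }
  have hδ : Monotone δ := fun a b hab k =>
    Subtype.mk_le_mk.2 (hγ _ (monotone_subsegment hst.le hab))
  convert IsDPath.cell x δ hδ using 1
  ext r
  apply hf.homeo.injective
  apply Subtype.ext
  change ((hf.homeo (hf.homeo.symm (γ (subsegment s t r)))) : EuclideanSpace ℝ (Fin d)) =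
    (f.tuple x).point (δ r)
  rw [Homeomorph.apply_symm_apply]
  exact (f.tuple x).point_ext _ _ (fun k => rfl)
    fun i b hb => hsome i b hb _ (subsegment_mem_Icc hst.le r)

/-- Each coordinate has two switching times, when it becomes positive and when it reaches $1$.
Cutting at all of them leaves segments with constant carrier. -/
theorem Hom.IsEmbedding.isDirected_homeo_symm {f : Hom X (bulk d)} (hf : f.IsEmbedding) :
    (subsetDStructure (Set.range f.realize)).IsDirected X.realizationDStructure hf.homeo.symm := by
  classical
  intro γ hγ
  choose c hc using fun i => exists_switch (p := fun r => 0 < (γ r).1 i)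
    fun r r' h h' => h'.trans_le (hγ i h)
  choose c' hc' using fun i => exists_switch (p := fun r => 1 ≤ (γ r).1 i)
    fun r r' h h' => h'.trans (hγ i h)
  refine X.realizationDStructure.mem_of_segments _
    (Finset.univ.image c ∪ Finset.univ.image c') fun s t hst hT => ?_
  exact hf.segment_mem hγ hst (fun i => hc i s t (hT _ (by simp)))
    (fun i => hc' i s t (hT _ (by simp)))

theorem Sculptable.isEuclidean (h : X.Sculptable) : X.IsEuclidean := by
  obtain ⟨d, f, hf⟩ := h
  refine ⟨d, _, isEuclideanCubicalComplex_range hf, hf.homeo, hf.isDirected_homeo,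
    hf.isDirected_homeo_symm, fun x p q => (f.tuple x).dist_point p q, ?_⟩
  intro n x j k hjk p p' q q' hp hq a b ha hb
  rw [(f.tuple x).eq_position_of_point_ne hp ha, (f.tuple x).eq_position_of_point_ne hq hb]
  exact (f.tuple x).position_strictMono hjk

end PrecubicalSet

/-! ### The cubes of a Euclidean cubical complex -/

/-- A complex that contains a point with a non-integral coordinate contains a segment in the
direction of that coordinate around the point. -/
theorem IsEuclideanCubicalComplex.exists_add_single_mem {N : ℕ}
    {C : Set (EuclideanSpace ℝ (Fin N))} (hC : IsEuclideanCubicalComplex C)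
    {q : EuclideanSpace ℝ (Fin N)} (hq : q ∈ C) {a : Fin N} (ha : ∀ z : ℤ, q a ≠ z) :
    ∃ δ > 0, ∀ e : ℝ, |e| < δ → q + e • EuclideanSpace.single a (1 : ℝ) ∈ C := by
  obtain ⟨F, -, hF, rfl⟩ := hC
  obtain ⟨S, hS, hqS⟩ := hq
  obtain ⟨l, r, -, rfl⟩ := hF S hS
  have h1 := lt_of_le_of_ne (hqS a).1 (ha _).symm
  have h2 := lt_of_le_of_ne (hqS a).2 (ha _)
  refine ⟨min (q a - l a) (r a - q a), lt_min (by linarith) (by linarith), fun e he =>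
    ⟨_, hS, fun i => ?_⟩⟩
  by_cases hi : i = a
  · subst hi
    have h3 := abs_lt.1 (he.trans_le (min_le_left _ _))
    have h4 := abs_lt.1 (he.trans_le (min_le_right _ _))
    simp only [PiLp.add_apply, PiLp.smul_apply, PiLp.single_apply, if_true, smul_eq_mul, mul_one]
    constructor <;> linarith
  · simpa [hi] using hqS i

/-- The inner products determine the squared norm of the difference of the two sides, and it is
zero. No linearity of `φ` is assumed. -/
theorem eq_sum_smul_of_inner_eq {E : Type*} [NormedAddCommGroup E] [InnerProductSpace ℝ E] {n : ℕ}
    (φ : (Fin n → I) → E) (hφ : ∀ p q, inner ℝ (φ p) (φ q) = ∑ k, (p k : ℝ) * q k)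
    (p : Fin n → I) : φ p = ∑ k, (p k : ℝ) • φ (Pi.single k 1) := by
  have h0 : ∀ q k, inner ℝ (φ q) (φ (Pi.single k 1)) = q k := by
    intro q k
    rw [hφ, Finset.sum_eq_single k]
    · simp
    · intro j _ hj
      simp [hj]
    · simp
  have h1 : ∀ q, inner ℝ (φ q) (∑ k, (p k : ℝ) • φ (Pi.single k 1)) = ∑ k, (p k : ℝ) * q k := by
    intro q
    simp only [inner_sum, inner_smul_right, h0]
  have h2 : inner ℝ (∑ k, (p k : ℝ) • φ (Pi.single k 1)) (∑ k, (p k : ℝ) • φ (Pi.single k 1)) =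
      ∑ k, (p k : ℝ) * p k := by
    rw [sum_inner]
    refine Finset.sum_congr rfl fun k _ => ?_
    rw [real_inner_smul_left, h1, Finset.sum_eq_single k]
    · simp
    · intro j _ hj
      simp [hj]
    · simp
  rw [← sub_eq_zero, ← inner_self_eq_zero (𝕜 := ℝ), inner_sub_left, inner_sub_right,
    inner_sub_right, real_inner_comm (φ p) (∑ k, _), h1, h2, hφ]
  ring

namespace PrecubicalSet

variable {X : PrecubicalSet.{u}} {N : ℕ} {C : Set (EuclideanSpace ℝ (Fin N))}
  (h : X.Realization ≃ₜ C)

/-- The image in Euclidean space of a point of a cube. -/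
noncomputable def cubePoint {n : ℕ} (x : X.cell n) (p : Fin n → I) : EuclideanSpace ℝ (Fin N) :=
  h (X.cellMap x p)

/-- The image of the lowest vertex of a cube. -/
noncomputable def base {n : ℕ} (x : X.cell n) : EuclideanSpace ℝ (Fin N) := cubePoint h x 0

/-- The image of the `k`-th direction of a cube. -/
noncomputable def dir {n : ℕ} (x : X.cell n) (k : Fin n) : EuclideanSpace ℝ (Fin N) :=
  cubePoint h x (Pi.single k 1) - base h x

theorem continuous_cubePoint {n : ℕ} (x : X.cell n) : Continuous (cubePoint h x) := by
  unfold cubePoint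
  fun_prop

theorem cubePoint_face {n : ℕ} (α : Bool) (i : Fin (n + 1)) (x : X.cell (n + 1))
    (p : Fin n → I) : cubePoint h (X.face α i x) p = cubePoint h x (i.insertNth (endpoint α) p) :=
  congrArg (fun z => (h z : EuclideanSpace ℝ (Fin N))) (Quot.sound (Glue.face α i x p))

theorem cellMap_eq_of_cubePoint_eq {n m : ℕ} {x : X.cell n} {y : X.cell m} {p : Fin n → I}
    {q : Fin m → I} (he : cubePoint h x p = cubePoint h y q) : X.cellMap x p = X.cellMap y q :=
  h.injective (Subtype.ext he)

variable {h}

/-! ### Cubes under a d-isometry: affine form, axes and integral vertices -/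

namespace IsDIsometry

/-- Polarization of the preserved distances, with the lowest vertex as origin. -/
theorem inner_sub_base (hh : X.IsDIsometry C h) {n : ℕ} (x : X.cell n) (p q : Fin n → I) :
    inner ℝ (cubePoint h x p - base h x) (cubePoint h x q - base h x) =
      ∑ k, (p k : ℝ) * q k := by
  have hd : ∀ p q, ‖cubePoint h x p - cubePoint h x q‖ * ‖cubePoint h x p - cubePoint h x q‖ =
      ∑ k, ((p k : ℝ) - q k) ^ 2 := by
    intro p q
    have := hh.isometric x p q
    rw [Subtype.dist_eq, dist_eq_norm] at this
    change ‖cubePoint h x p - cubePoint h x q‖ = _ at this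
    rw [this, Real.mul_self_sqrt (Finset.sum_nonneg fun _ _ => sq_nonneg _)]
  rw [real_inner_eq_norm_mul_self_add_norm_mul_self_sub_norm_sub_mul_self_div_two,
    sub_sub_sub_cancel_right, base, hd, hd, hd, ← Finset.sum_add_distrib, ← Finset.sum_sub_distrib,
    Finset.sum_div]
  refine Finset.sum_congr rfl fun k _ => ?_
  simp only [Pi.zero_apply, Set.Icc.coe_zero]
  ring

theorem cubePoint_eq (hh : X.IsDIsometry C h) {n : ℕ} (x : X.cell n) (p : Fin n → I) :
    cubePoint h x p = base h x + ∑ k, (p k : ℝ) • dir h x k := by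
  rw [← sub_eq_iff_eq_add']
  exact eq_sum_smul_of_inner_eq (fun p => cubePoint h x p - base h x) (hh.inner_sub_base x) p

theorem sum_sub_smul_dir (hh : X.IsDIsometry C h) {n : ℕ} (x : X.cell n) (p q : Fin n → I) :
    ∑ k, ((p k : ℝ) - q k) • dir h x k = cubePoint h x p - cubePoint h x q := by
  simp only [hh.cubePoint_eq x p, hh.cubePoint_eq x q, sub_smul, Finset.sum_sub_distrib]
  abel

theorem cubePoint_update (hh : X.IsDIsometry C h) {n : ℕ} (x : X.cell n) (p : Fin n → I)
    (k : Fin n) (t : I) :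
    cubePoint h x (Function.update p k t) = cubePoint h x p + ((t : ℝ) - p k) • dir h x k := by
  rw [← sub_eq_iff_eq_add', ← hh.sum_sub_smul_dir, Finset.sum_eq_single k]
  · simp
  · intro j _ hj
    simp [hj]
  · simp

theorem base_face (hh : X.IsDIsometry C h) {n : ℕ} (α : Bool) (i : Fin (n + 1))
    (x : X.cell (n + 1)) :
    base h (X.face α i x) = base h x + (endpoint α : ℝ) • dir h x i := by
  rw [base, cubePoint_face, hh.cubePoint_eq, Fin.sum_univ_succAbove _ i]
  simp

theorem dir_face (hh : X.IsDIsometry C h) {n : ℕ} (α : Bool) (i : Fin (n + 1))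
    (x : X.cell (n + 1)) (k : Fin n) :
    dir h (X.face α i x) k = dir h x (i.succAbove k) := by
  rw [dir, base, cubePoint_face, cubePoint_face, ← hh.sum_sub_smul_dir,
    Fin.sum_univ_succAbove _ i, Finset.sum_eq_single k]
  · simp
  · intro j _ hj
    simp [hj]
  · simp

theorem exists_dir_eq_of_reduces (hh : X.IsDIsometry C h) {a b : X.Cubes}
    (hab : Relation.ReflTransGen X.Reduces a b) (k : Fin b.1.1) :
    ∃ j, dir h b.1.2 k = dir h a.1.2 j := by
  induction hab with
  | refl => exact ⟨k, rfl⟩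
  | tail _ hr ih =>
    obtain ⟨α, i, x, p⟩ := hr
    obtain ⟨j, hj⟩ := ih (i.succAbove k)
    exact ⟨j, (hh.dir_face α i x k).trans hj⟩

theorem lt_of_dir_ne_zero (hh : X.IsDIsometry C h) {n : ℕ} (x : X.cell n) {j k : Fin n}
    (hjk : j < k) {a b : Fin N} (ha : dir h x j a ≠ 0) (hb : dir h x k b ≠ 0) : a < b := by
  refine hh.order_directions x j k hjk (Pi.single j 1) 0 (Pi.single k 1) 0
    (fun i hi => by simp [hi]) (fun i hi => by simp [hi]) a b ?_ ?_
  · rw [← sub_ne_zero]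
    exact ha
  · rw [← sub_ne_zero]
    exact hb

/-- A common axis `a` of two distinct directions would give `a < a`; so distinct directions of a
cube have disjoint supports. -/
theorem eq_of_dir_ne_zero (hh : X.IsDIsometry C h) {n : ℕ} (x : X.cell n) {j k : Fin n}
    {a : Fin N} (hj : dir h x j a ≠ 0) (hk : dir h x k a ≠ 0) : j = k := by
  rcases lt_trichotomy j k with hjk | hjk | hjk
  · exact absurd (hh.lt_of_dir_ne_zero x hjk hj hk) (lt_irrefl a)
  · exact hjk
  · exact absurd (hh.lt_of_dir_ne_zero x hjk hk hj) (lt_irrefl a)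

/-- The edge from the lowest vertex in direction `k` is a directed path. -/
theorem dir_nonneg (hh : X.IsDIsometry C h) {n : ℕ} (x : X.cell n) (k : Fin n) (a : Fin N) :
    0 ≤ dir h x k a := by
  let γ : C(I, Fin n → I) := ⟨fun t => Function.update 0 k t, by fun_prop⟩
  have hγ : Monotone γ := fun s t hst => Pi.single_mono k hst
  have := hh.directed _ (IsDPath.cell x γ hγ) a (zero_le_one' I)
  change cubePoint h x (Pi.single k 0) a ≤ cubePoint h x (Pi.single k 1) a at this
  rw [Pi.single_zero] at this
  exact sub_nonneg.2 this

theorem sum_dir_sq (hh : X.IsDIsometry C h) {n : ℕ} (x : X.cell n) (k : Fin n) :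
    ∑ a, dir h x k a ^ 2 = 1 := by
  have := hh.inner_sub_base x (Pi.single k 1) (Pi.single k 1)
  rw [Finset.sum_eq_single k (fun j _ hj => by simp [hj]) (by simp)] at this
  change inner ℝ (dir h x k) (dir h x k) = _ at this
  rw [PiLp.inner_apply] at this
  simpa [sq] using this

theorem dir_eq_single (hh : X.IsDIsometry C h) {n : ℕ} (x : X.cell n) (k : Fin n) {a : Fin N}
    (ha : ∀ b, b ≠ a → dir h x k b = 0) : dir h x k = EuclideanSpace.single a 1 := by
  have h1 := hh.sum_dir_sq x k
  rw [Finset.sum_eq_single a (fun b _ hb => by simp [ha b hb]) (by simp)] at h1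
  have h2 : dir h x k a = 1 := by
    rcases sq_eq_one_iff.1 h1 with h2 | h2
    · exact h2
    · linarith [hh.dir_nonneg x k a]
  ext b
  by_cases hb : b = a
  · simp [hb, h2]
  · simp [hb, ha b hb]

/-- If an interior point of a cube can be moved a little in a coordinate direction, then the cube is
a face of a cube that extends in this direction. -/
theorem exists_dir_eq_single [Finite (Σ n, X.cell n)] (hh : X.IsDIsometry C h) {n : ℕ}
    (x : X.cell n) {p : Fin n → I} (hp : IsInterior p) (a : Fin N) (s : ℝ) (hs : s ≠ 0) {δ : ℝ}
    (hδ : 0 < δ) (hC : ∀ e ∈ Set.Ioo 0 δ,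
      cubePoint h x p + (e * s) • EuclideanSpace.single a (1 : ℝ) ∈ C) :
    ∃ (m : ℕ) (y : X.cell m) (q : Fin m → I) (k : Fin m),
      Relation.ReflTransGen X.Reduces ⟨⟨m, y⟩, q⟩ ⟨⟨n, x⟩, p⟩ ∧ cubePoint h y q = cubePoint h x p ∧
      dir h y k = EuclideanSpace.single a 1 ∧ ∃ c : I, 0 < s * ((c : ℝ) - q k) := by
  let g : ℝ → EuclideanSpace ℝ (Fin N) :=
    fun e => cubePoint h x p + (e * s) • EuclideanSpace.single a (1 : ℝ)
  have hg : Continuous g := by fun_prop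
  have h0 : cubePoint h x p ∈ closure (g '' Set.Ioo 0 δ) := by
    have h1 : (0 : ℝ) ∈ closure (Set.Ioo 0 δ) := by
      rw [closure_Ioo hδ.ne]
      exact Set.left_mem_Icc.2 hδ.le
    have := image_closure_subset_closure_image hg ⟨0, h1, rfl⟩
    simpa [g] using this
  have hsub : g '' Set.Ioo 0 δ ⊆
      ⋃ y : Σ m, X.cell m, Set.range (cubePoint h y.2) ∩ g '' Set.Ioo 0 δ := by
    rintro _ ⟨e, he, rfl⟩
    obtain ⟨m, y, q, -, hq⟩ := exists_cellMap_eq_isInterior (h.symm ⟨_, hC e he⟩)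
    refine Set.mem_iUnion.2 ⟨⟨m, y⟩, ⟨q, ?_⟩, e, he, rfl⟩
    simp only [cubePoint, hq, Homeomorph.apply_symm_apply, g]
  have h1 := closure_mono hsub h0
  -- Since there are finitely many cells, a single cube `y` meets the segment arbitrarily close to
  -- the given point; being compact, it contains that point too.
  rw [closure_iUnion_of_finite] at h1
  obtain ⟨⟨m, y⟩, hy⟩ := Set.mem_iUnion.1 h1
  obtain ⟨_, ⟨q', hq'⟩, e, he, rfl⟩ := closure_nonempty_iff.1 ⟨_, hy⟩
  have hcl : IsClosed (Set.range (cubePoint h y)) :=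
    (isCompact_range (continuous_cubePoint h y)).isClosed
  obtain ⟨q, hq⟩ := hcl.closure_subset_iff.2 Set.inter_subset_left hy
  have hsum := hh.sum_sub_smul_dir y q' q
  rw [hq, hq', add_sub_cancel_left] at hsum
  have hcoord : ∀ b, ∑ k, ((q' k : ℝ) - q k) * dir h y k b =
      e * s * (EuclideanSpace.single a (1 : ℝ) : EuclideanSpace ℝ (Fin N)) b := by
    intro b
    have := congrArg (fun z : EuclideanSpace ℝ (Fin N) => z b) hsum
    simpa using this
  have hne : e * s ≠ 0 := mul_ne_zero he.1.ne' hs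
  obtain ⟨k, -, hk⟩ := Finset.exists_ne_zero_of_sum_ne_zero
    (s := Finset.univ) (f := fun k => ((q' k : ℝ) - q k) * dir h y k a)
    (by rw [hcoord]; simpa using hne)
  -- Supports are disjoint, so on the support of direction `k` only the `k`-th term of the
  -- displacement survives.
  have hcoord' : ∀ b, dir h y k b ≠ 0 → ((q' k : ℝ) - q k) * dir h y k b =
      e * s * (EuclideanSpace.single a (1 : ℝ) : EuclideanSpace ℝ (Fin N)) b := by
    intro b hb
    rw [← hcoord b, Finset.sum_eq_single k]
    · intro j _ hj
      by_contra hj'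
      exact hj (hh.eq_of_dir_ne_zero y (right_ne_zero_of_mul hj') hb)
    · simp
  -- The displacement vanishes off axis `a`, so a further axis in the support would force `q' k = q
  -- k`, against the choice of `k`.
  have hdir : dir h y k = EuclideanSpace.single a 1 := by
    refine hh.dir_eq_single y k fun b hb => ?_
    by_contra hkb
    have := hcoord' b hkb
    simp [hb, hkb] at this
    exact left_ne_zero_of_mul hk (by simp [this])
  refine ⟨m, y, q, k, hp.reduces (cellMap_eq_of_cubePoint_eq h hq), hq, hdir, q' k, ?_⟩
  have := hcoord' a (right_ne_zero_of_mul hk)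
  simp [hdir] at this
  rw [this]
  have := he.1
  have : 0 < s * s := mul_self_pos.2 hs
  nlinarith

/-- If direction `k` has an `a`-component, some interior point of the cube has a non-integral
`a`-coordinate. There the complex continues along axis `a`, so the cube is a face of one that has
the coordinate vector of `a` as a direction. -/
theorem exists_axis [Finite (Σ n, X.cell n)] (hh : X.IsDIsometry C h)
    (hC : IsEuclideanCubicalComplex C) {n : ℕ} (x : X.cell n) (k : Fin n) :
    ∃ a : Fin N, dir h x k = EuclideanSpace.single a 1 := by
  obtain ⟨a, -, ha⟩ := Finset.exists_ne_zero_of_sum_ne_zero (s := Finset.univ)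
    (f := fun a => dir h x k a ^ 2) (by rw [hh.sum_dir_sq]; exact one_ne_zero)
  replace ha : dir h x k a ≠ 0 := by simpa using ha
  have ha0 : 0 < dir h x k a := lt_of_le_of_ne (hh.dir_nonneg x k a) ha.symm
  set c := cubePoint h x (Function.update (midpoint n) k 0) a with hc
  -- Moving the midpoint in direction `k` sweeps the `a`-coordinates from `c` to `c + dir h x k a`;
  -- the parameter `t` below is where the value is `r`.
  obtain ⟨r, hr, h1, h2⟩ := exists_irrational_btwn (lt_add_of_pos_right c ha0)
  have ht0 : 0 < (r - c) / dir h x k a := div_pos (by linarith) ha0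
  have ht1 : (r - c) / dir h x k a < 1 := (div_lt_one ha0).2 (by linarith)
  let t : I := ⟨(r - c) / dir h x k a, ht0.le, ht1.le⟩
  let p : Fin n → I := Function.update (midpoint n) k t
  have hp : IsInterior p := by
    intro j
    by_cases hj : j = k
    · subst hj
      simp only [p, Function.update_self]
      exact ⟨Subtype.mk_lt_mk.2 ht0, Subtype.mk_lt_mk.2 ht1⟩
    · simp only [p, Function.update_of_ne hj]
      exact isInterior_midpoint n j
  have hpa : cubePoint h x p a = r := by
    have : p = Function.update (Function.update (midpoint n) k 0) k t := by simp [p]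
    rw [this, hh.cubePoint_update, PiLp.add_apply, ← hc]
    simp [t, div_mul_cancel₀ _ ha]
  obtain ⟨δ, hδ, hm⟩ := hC.exists_add_single_mem (q := cubePoint h x p) (h _).2 (a := a)
    (by rw [hpa]; exact fun z => hr.ne_int z)
  obtain ⟨m, y, q, j, hred, -, hj, -⟩ := hh.exists_dir_eq_single x hp a 1 one_ne_zero hδ
    fun e he => hm _ (by rw [mul_one, abs_of_pos he.1]; exact he.2)
  obtain ⟨i, hi⟩ := hh.exists_dir_eq_of_reduces hred k
  dsimp only at hi
  -- Both are directions of the same cube `y` with a nonzero `a`-component.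
  obtain rfl : i = j := hh.eq_of_dir_ne_zero y (a := a) (hi ▸ ha) (by simp [hj])
  exact ⟨a, hi.trans hj⟩

/-- A vertex with least non-integral `a`-coordinate is the upper end of an edge along axis `a`,
because the complex continues downwards there. The lower end is one unit below, still non-integral:
a contradiction. -/
theorem exists_base_vertex_eq_int [Finite (Σ n, X.cell n)] (hh : X.IsDIsometry C h)
    (hC : IsEuclideanCubicalComplex C) (v : X.cell 0) (a : Fin N) : ∃ z : ℤ, base h v a = z := by
  have hfin : Finite (X.cell 0) :=
    Finite.of_injective (Sigma.mk (β := X.cell) 0) sigma_mk_injective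
  by_contra! hv
  obtain ⟨w, hw, hmin⟩ := Set.exists_min_image {w : X.cell 0 | ∀ z : ℤ, base h w a ≠ z}
    (fun w => base h w a) (Set.toFinite _) ⟨v, hv⟩
  obtain ⟨δ, hδ, hm⟩ := hC.exists_add_single_mem (q := base h w) (h _).2 hw
  obtain ⟨m, y, q, k, hred, hq, hk, c, hck⟩ := hh.exists_dir_eq_single w (p := 0)
    (fun k => k.elim0) a (-1) (by norm_num) hδ
    fun e he => hm _ (by rw [mul_neg_one, abs_neg, abs_of_pos he.1]; exact he.2)
  have hq01 := eq_endpoint_of_reduces hred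
  -- With `s = -1`, the bound on `c` says `c < q k`, which excludes `q k = 0`.
  have hqk : q k = 1 := by
    refine (hq01 k).resolve_left fun h0 => ?_
    rw [h0] at hck
    have := c.2.1
    simp at hck
    linarith
  obtain ⟨w', hw'⟩ := exists_vertex y (Function.update q k 0) (fun j => by
    by_cases hj : j = k
    · simp [hj]
    · simpa [hj] using hq01 j)
  have hb : base h w' a = base h w a - 1 := by
    have h1 : base h w' = cubePoint h y (Function.update q k 0) := by
      rw [cubePoint, hw', base, cubePoint, Subsingleton.elim 0 ![]]
    rw [h1, hh.cubePoint_update, hqk, hq, hk, PiLp.add_apply]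
    simp [base, sub_eq_add_neg]
  have := hmin w' fun z hz => hw (z + 1) (by push_cast; linarith)
  linarith

theorem exists_base_eq_int [Finite (Σ n, X.cell n)] (hh : X.IsDIsometry C h)
    (hC : IsEuclideanCubicalComplex C) {n : ℕ} (x : X.cell n) (a : Fin N) :
    ∃ z : ℤ, base h x a = z := by
  obtain ⟨v, hv⟩ := exists_vertex x 0 fun k => .inl rfl
  have h1 : base h x = base h v := by
    rw [base, cubePoint, hv, base, cubePoint, Subsingleton.elim 0 ![]]
  rw [h1]
  exact hh.exists_base_vertex_eq_int hC v a

end IsDIsometry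

end PrecubicalSet

/-! ### From the integer grid to a bulk -/

namespace PrecubicalSet

/-- A realization of the cells of `X` as cubes of the integer grid in a bounded part of `ℝ^N`. -/
structure GridEmbedding (X : PrecubicalSet.{u}) (N M : ℕ) where
  /-- The coordinates in which a cube extends. -/
  axis : ∀ {n : ℕ}, X.cell n → Fin n → Fin N
  /-- The lowest vertex of a cube. -/
  low : ∀ {n : ℕ}, X.cell n → Fin N → ℤ
  axis_strictMono : ∀ {n : ℕ} (x : X.cell n), StrictMono (axis x)
  axis_face : ∀ {n : ℕ} (α : Bool) (i : Fin (n + 1)) (x : X.cell (n + 1)) (k : Fin n),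
    axis (X.face α i x) k = axis x (i.succAbove k)
  low_face : ∀ {n : ℕ} (α : Bool) (i : Fin (n + 1)) (x : X.cell (n + 1)) (a : Fin N),
    low (X.face α i x) a = low x a + if α = true ∧ a = axis x i then 1 else 0
  low_mem : ∀ {n : ℕ} (x : X.cell n) (a : Fin N), low x a ∈ Set.Icc (-M : ℤ) M
  injective : ∀ {n : ℕ} (x y : X.cell n), axis x = axis y → low x = low y → x = y

namespace GridEmbedding

variable {X : PrecubicalSet.{u}} {N M : ℕ} (G : GridEmbedding X N M)

/-- The axis of a coordinate of the bulk: the coordinates of the bulk correspond to the unit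
intervals on the axes. -/
def axisOf (i : Fin (N * (2 * M + 1))) : Fin N := (finProdFinEquiv.symm i).1

/-- The lower endpoint of the unit interval of a coordinate of the bulk. -/
def lowOf (i : Fin (N * (2 * M + 1))) : ℤ := ((finProdFinEquiv.symm i).2 : ℕ) - M

/-- The coordinate of the bulk that corresponds to a unit interval on an axis. -/
def index (a : Fin N) (z : ℤ) (hz : z ∈ Set.Icc (-M : ℤ) M) : Fin (N * (2 * M + 1)) :=
  finProdFinEquiv (a, ⟨(z + M).toNat, by have := hz.1; have := hz.2; omega⟩)

theorem axisOf_index (a : Fin N) (z : ℤ) (hz : z ∈ Set.Icc (-M : ℤ) M) :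
    axisOf (index a z hz) = a := by
  simp [axisOf, index]

theorem lowOf_index (a : Fin N) (z : ℤ) (hz : z ∈ Set.Icc (-M : ℤ) M) :
    lowOf (index a z hz) = z := by
  have := hz.1
  simp only [lowOf, index, Equiv.symm_apply_apply]
  omega

theorem eq_index {a : Fin N} {z : ℤ} (hz : z ∈ Set.Icc (-M : ℤ) M) {i : Fin (N * (2 * M + 1))}
    (ha : axisOf i = a) (hi : lowOf i = z) : i = index a z hz := by
  subst ha hi
  rw [index, ← Equiv.symm_apply_eq]
  refine Prod.ext rfl (Fin.ext ?_)
  simp only [lowOf]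
  omega

/-- Bulk coordinates come in blocks of $2M+1$, one block for each axis, so the order of the axes
alone decides. This is what preserves the numbering of directions. -/
theorem index_lt_index {a b : Fin N} (hab : a < b) {z w : ℤ} (hz : z ∈ Set.Icc (-M : ℤ) M)
    (hw : w ∈ Set.Icc (-M : ℤ) M) : index a z hz < index b w hw := by
  have h1 : (a : ℕ) + 1 ≤ b := hab
  have h2 : (z + M).toNat < 2 * M + 1 := by have := hz.1; have := hz.2; omega
  rw [Fin.lt_def]
  simp only [index, finProdFinEquiv_apply_val]
  nlinarith [Nat.mul_le_mul_left (2 * M + 1) h1]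

open Classical in
/-- The tuple of a cell. -/
noncomputable def tuple {n : ℕ} (x : X.cell n) (i : Fin (N * (2 * M + 1))) : Option Bool :=
  -- The cube lies beyond the unit interval, extends across it, or lies at or before its lower end.
  if lowOf i < G.low x (axisOf i) then some true
  else if G.low x (axisOf i) = lowOf i ∧ ∃ k, G.axis x k = axisOf i then none
  else some false

/-- The executing positions of the tuple of a cell. -/
def position {n : ℕ} (x : X.cell n) (k : Fin n) : Fin (N * (2 * M + 1)) :=
  index (G.axis x k) (G.low x (G.axis x k)) (G.low_mem _ _)

theorem position_strictMono {n : ℕ} (x : X.cell n) : StrictMono (G.position x) :=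
  fun _ _ hjk => index_lt_index (G.axis_strictMono x hjk) _ _

theorem tuple_eq_none_iff {n : ℕ} (x : X.cell n) (i : Fin (N * (2 * M + 1))) :
    G.tuple x i = none ↔ ∃ k, G.position x k = i := by
  unfold tuple
  split_ifs with h1 h2
  · refine iff_of_false (by simp) ?_
    rintro ⟨k, rfl⟩
    rw [position, axisOf_index, lowOf_index] at h1
    exact lt_irrefl _ h1
  · obtain ⟨h2, k, hk⟩ := h2
    exact iff_of_true rfl ⟨k, (eq_index _ hk.symm (by rw [hk, h2])).symm⟩
  · refine iff_of_false (by simp) ?_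
    rintro ⟨k, rfl⟩
    rw [position, axisOf_index, lowOf_index] at h2
    exact h2 ⟨rfl, k, rfl⟩

theorem executing_tuple {n : ℕ} (x : X.cell n) :
    executing (G.tuple x) = Finset.univ.image (G.position x) := by
  ext i
  simp [executing, tuple_eq_none_iff]

/-- The cell of the bulk that corresponds to a cell. -/
noncomputable def bulkCell {n : ℕ} (x : X.cell n) : BulkCell (N * (2 * M + 1)) n :=
  ⟨G.tuple x, by
    rw [executing_tuple, Finset.card_image_of_injective _ (G.position_strictMono x).injective,
      Finset.card_univ, Fintype.card_fin]⟩

theorem position_bulkCell {n : ℕ} (x : X.cell n) : (G.bulkCell x).position = G.position x := by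
  refine (Finset.orderEmbOfFin_unique (G.bulkCell x).2 (fun k => ?_)
    (G.position_strictMono x)).symm
  change _ ∈ executing (G.tuple x)
  simp [executing_tuple]

theorem bulkCell_face {n : ℕ} (α : Bool) (i : Fin (n + 1)) (x : X.cell (n + 1)) :
    G.bulkCell (X.face α i x) = (G.bulkCell x).face α i := by
  apply Subtype.ext
  change G.tuple (X.face α i x) =
    Function.update (G.tuple x) ((G.bulkCell x).position i) (some α)
  rw [position_bulkCell]
  funext j
  by_cases hj : j = G.position x i
  · subst hj
    have h : ¬ ∃ k, G.axis x (i.succAbove k) = G.axis x i := by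
      rintro ⟨k, hk⟩
      exact Fin.succAbove_ne i k ((G.axis_strictMono x).injective hk)
    rw [Function.update_self, tuple]
    simp only [position, axisOf_index, lowOf_index, G.low_face, G.axis_face, h]
    cases α <;> simp
  · rw [Function.update_of_ne hj]
    by_cases ha : axisOf j = G.axis x i
    · have hne : G.low x (axisOf j) ≠ lowOf j := by
        intro he
        exact hj (eq_index _ ha (by rw [← he, ha]))
      have h : ¬ ∃ k, G.axis x (i.succAbove k) = G.axis x i := by
        rintro ⟨k, hk⟩
        exact Fin.succAbove_ne i k ((G.axis_strictMono x).injective hk)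
      rw [ha] at hne
      simp only [tuple, G.low_face, G.axis_face, ha, h, and_true, and_false, if_false, hne,
        false_and]
      -- An upper face raises `low` by one, but this crosses only the interval starting at `low`,
      -- which `hne` excludes; comparison with any other interval is unchanged.
      by_cases hlt : lowOf j < G.low x (G.axis x i)
      · rw [if_pos hlt, if_pos]
        split_ifs <;> omega
      · rw [if_neg hlt, if_neg]
        split_ifs <;> omega
    · have h : (∃ k, G.axis x (i.succAbove k) = axisOf j) ↔ ∃ k, G.axis x k = axisOf j := by
        constructor
        · rintro ⟨k, hk⟩
          exact ⟨_, hk⟩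
        · rintro ⟨k, hk⟩
          rcases Fin.eq_self_or_eq_succAbove i k with rfl | ⟨k, rfl⟩
          · exact absurd hk.symm ha
          · exact ⟨k, hk⟩
      simp only [tuple, G.low_face, G.axis_face, ha, h, and_false, if_false, add_zero]

/-- The interval starting at `low y a` separates the tuples otherwise: `x` is beyond it and `y` is
not. -/
theorem low_le_of_tuple_eq {n : ℕ} {x y : X.cell n} (h : G.tuple x = G.tuple y)
    (a : Fin N) : G.low x a ≤ G.low y a := by
  by_contra! hlt
  have h1 := congrFun h (index a (G.low y a) (G.low_mem _ _))
  have h2 : G.tuple x (index a (G.low y a) (G.low_mem _ _)) = some true := by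
    rw [tuple, axisOf_index, lowOf_index, if_pos hlt]
  rw [h2] at h1
  rw [tuple, axisOf_index, lowOf_index, if_neg (lt_irrefl _)] at h1
  split_ifs at h1
  simp at h1

theorem bulkCell_injective (n : ℕ) :
    Function.Injective (G.bulkCell : X.cell n → BulkCell (N * (2 * M + 1)) n) := by
  intro x y h
  have ht : G.tuple x = G.tuple y := congrArg Subtype.val h
  refine G.injective x y (funext fun k => ?_) (funext fun a =>
    le_antisymm (G.low_le_of_tuple_eq ht a) (G.low_le_of_tuple_eq ht.symm a))
  have hp : G.position x k = G.position y k := by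
    rw [← position_bulkCell, ← position_bulkCell, h]
  rw [← axisOf_index (G.axis x k) _ (G.low_mem x (G.axis x k)),
    ← axisOf_index (G.axis y k) _ (G.low_mem y (G.axis y k))]
  exact congrArg axisOf hp

include G in
theorem sculptable : X.Sculptable :=
  ⟨_, { app := fun _ x => G.bulkCell x, app_face := G.bulkCell_face }, G.bulkCell_injective⟩

end GridEmbedding

/-! ### Euclidean precubical sets can be sculpted -/

theorem IsDIsometry.exists_gridEmbedding {X : PrecubicalSet.{u}} [Finite (Σ n, X.cell n)] {N : ℕ}
    {C : Set (EuclideanSpace ℝ (Fin N))} {h : X.Realization ≃ₜ C} (hh : X.IsDIsometry C h)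
    (hC : IsEuclideanCubicalComplex C) : ∃ M : ℕ, Nonempty (GridEmbedding X N M) := by
  choose axis haxis using fun n (x : X.cell n) => hh.exists_axis hC x
  choose low hlow using fun n (x : X.cell n) => hh.exists_base_eq_int hC x
  obtain ⟨M, hM⟩ : ∃ M : ℕ, ∀ n (x : X.cell n) a, |low n x a| ≤ M := by
    obtain ⟨M, hM⟩ := (Set.finite_range
      fun z : (Σ n, X.cell n) × Fin N => (low z.1.1 z.1.2 z.2).natAbs).bddAbove
    refine ⟨M, fun n x a => ?_⟩
    rw [Int.abs_eq_natAbs]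
    exact_mod_cast hM ⟨(⟨n, x⟩, a), rfl⟩
  have hdir : ∀ n (x : X.cell n) k, dir h x k (axis n x k) ≠ 0 := by
    intro n x k
    simp [haxis]
  refine ⟨M, ⟨{
    axis := axis _
    low := low _
    axis_strictMono := fun x j k hjk => hh.lt_of_dir_ne_zero x hjk (hdir _ x j) (hdir _ x k)
    axis_face := fun {n} α i x k => ?_
    low_face := fun {n} α i x a => ?_
    low_mem := fun x a => abs_le.1 (hM _ x a)
    injective := fun {n} x y ha hl => ?_ }⟩⟩
  · by_contra hne
    have := hdir _ (X.face α i x) k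
    rw [hh.dir_face, haxis] at this
    simp [hne] at this
  · have h1 := hlow _ (X.face α i x) a
    rw [hh.base_face, PiLp.add_apply, hlow, haxis] at h1
    have h2 : (low _ (X.face α i x) a : ℝ) =
        (low _ x a + if α = true ∧ a = axis _ x i then 1 else 0 : ℤ) := by
      rw [← h1]
      cases α <;> simp [endpoint, PiLp.single_apply]
    exact_mod_cast h2
  · have hb : base h x = base h y := by
      ext a
      rw [hlow, hlow, hl]
    -- Lowest vertex and axes determine the image of the cube, so the two cells have the same
    -- centre.
    have hp : cubePoint h x (midpoint n) = cubePoint h y (midpoint n) := by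
      simp only [hh.cubePoint_eq, hb, haxis, ha]
    have := center_injective (a₁ := ⟨n, x⟩) (a₂ := ⟨n, y⟩) (cellMap_eq_of_cubePoint_eq h hp)
    simpa using this

theorem IsEuclidean.sculptable {X : PrecubicalSet.{u}} (hX : X.IsEuclidean) : X.Sculptable := by
  obtain ⟨N, C, hC, h, hh⟩ := hX
  have hcomp : IsCompact C := by
    obtain ⟨F, hF, hS, rfl⟩ := hC
    refine hF.isCompact_sUnion fun S hSF => ?_
    obtain ⟨a, b, -, rfl⟩ := hS S hSF
    have := isCompact_univ_pi fun i => isCompact_Icc (a := (a i : ℝ)) (b := b i)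
    convert (EuclideanSpace.equiv (Fin N) ℝ).toHomeomorph.isCompact_preimage.2 this
    ext y
    simp only [Set.mem_preimage, Set.mem_univ_pi, Set.mem_Icc]
    rfl
  have : CompactSpace C := isCompact_iff_compactSpace.1 hcomp
  have : CompactSpace X.Realization := h.symm.compactSpace
  have : Finite (Σ n, X.cell n) := finite_cells_of_compactSpace
  obtain ⟨M, ⟨G⟩⟩ := hh.exists_gridEmbedding hC
  exact G.sculptable

theorem sculptable_iff_isEuclidean (X : PrecubicalSet.{u}) : X.Sculptable ↔ X.IsEuclidean :=
  ⟨Sculptable.isEuclidean, IsEuclidean.sculptable⟩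

end PrecubicalSet

/-! ### The initial state -/

namespace BulkCell

variable {d n : ℕ}

/-- Replace `1` by `0` in some coordinates in which the cell is not executing. -/
def lower (S : Finset (Fin d)) (c : BulkCell d n) (h : ∀ i ∈ S, c.1 i ≠ none) : BulkCell d n :=
  ⟨fun i => if i ∈ S then some false else c.1 i, by
    refine (congrArg Finset.card ?_).trans c.2
    ext i
    by_cases hi : i ∈ S <;> simp [executing, hi, h]⟩

theorem executing_lower (S : Finset (Fin d)) (c : BulkCell d n) (h : ∀ i ∈ S, c.1 i ≠ none) :
    executing (c.lower S h).1 = executing c.1 := by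
  ext i
  by_cases hi : i ∈ S <;> simp [executing, lower, hi, h]

theorem position_lower (S : Finset (Fin d)) (c : BulkCell d n) (h : ∀ i ∈ S, c.1 i ≠ none) :
    (c.lower S h).position = c.position := by
  refine (Finset.orderEmbOfFin_unique (c.lower S h).2 (fun k => ?_) c.position_strictMono).symm
  rw [executing_lower]
  exact c.position_mem k

end BulkCell

/-- No step of a path destroys a $1$: the coordinate a step starts executing was $0$, and the one it
terminates becomes $1$. -/
theorem HDA.Connected.apply_eq_some_true {Q : HDA.{u}} (hQ : Q.Connected) {d : ℕ}
    (f : PrecubicalSet.Hom Q.toPrecubicalSet (bulk d)) {i : Fin d}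
    (hi : (f.tuple Q.init).1 i = some true) {n : ℕ} (x : Q.cell n) :
    (f.tuple x).1 i = some true := by
  suffices h : ∀ z : Σ n, Q.cell n,
      Relation.ReflTransGen Q.toPrecubicalSet.Step ⟨0, Q.init⟩ z → (f.tuple z.2).1 i = some true from
    h ⟨n, x⟩ (hQ _)
  intro z hz
  induction hz with
  | refl => exact hi
  | tail _ hs ih =>
    cases hs with
    | start j q =>
      dsimp only at ih ⊢
      rw [f.tuple_face] at ih
      change Function.update (f.tuple q).1 _ _ _ = _ at ih
      by_cases h : i = (f.tuple q).position j
      · subst h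
        simp at ih
      · rwa [Function.update_of_ne h] at ih
    | terminate j q =>
      dsimp only at ih ⊢
      rw [f.tuple_face]
      change Function.update (f.tuple q).1 _ _ _ = _
      by_cases h : i = (f.tuple q).position j
      · subst h
        simp
      · rwa [Function.update_of_ne h]

/-- The coordinates that are $1$ initially are $1$ on all cells. They distinguish no cells and never
execute, so setting them to $0$ keeps the embedding and sends the initial cell to the origin. -/
theorem HDA.Connected.sculptable {Q : HDA.{u}} (hQ : Q.Connected)
    (h : Q.toPrecubicalSet.Sculptable) : Q.Sculptable := by
  obtain ⟨d, f, hf⟩ := h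
  let S : Finset (Fin d) := Finset.univ.filter fun i => (f.tuple Q.init).1 i = some true
  have hS : ∀ i ∈ S, ∀ {n : ℕ} (x : Q.cell n), (f.tuple x).1 i = some true := fun i hi n x =>
    hQ.apply_eq_some_true f (by simpa [S] using hi) x
  have hS' : ∀ {n : ℕ} (x : Q.cell n), ∀ i ∈ S, (f.tuple x).1 i ≠ none := fun x i hi => by
    simp [hS i hi x]
  refine ⟨d, { app := fun n x => (f.tuple x).lower S (hS' x), app_face := ?_ }, ?_, ?_⟩
  · intro n α j x
    apply Subtype.ext
    change ((f.tuple (Q.face α j x)).lower S (hS' _)).1 =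
      Function.update ((f.tuple x).lower S (hS' _)).1
        (((f.tuple x).lower S (hS' _)).position j) (some α)
    rw [BulkCell.position_lower]
    funext i
    simp only [BulkCell.lower, f.tuple_face]
    by_cases h : i = (f.tuple x).position j
    · subst h
      have hn : (f.tuple x).position j ∉ S := fun h =>
        hS' x _ h ((f.tuple x).apply_position j)
      rw [if_neg hn, Function.update_self]
      exact Function.update_self ..
    · rw [Function.update_of_ne h]
      congr 1
      exact Function.update_of_ne h _ _
  · intro n x y hxy
    refine hf n (Subtype.ext (funext fun i => ?_))
    change (f.tuple x).1 i = (f.tuple y).1 i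
    by_cases hi : i ∈ S
    · rw [hS i hi, hS i hi]
    · have := congrFun (congrArg Subtype.val hxy) i
      simpa [BulkCell.lower, hi] using this
  · apply Subtype.ext
    funext i
    change (if i ∈ S then some false else (f.tuple Q.init).1 i) = some false
    split_ifs with hi
    · rfl
    · cases h : (f.tuple Q.init).1 i with
      | none =>
        -- The initial cell has dimension $0$, so it has no executing entry.
        obtain ⟨k, -⟩ := BulkCell.exists_position _ h
        exact k.elim0
      | some b =>
        cases b
        · rfl
        · simp [S, h] at hi

theorem mainTheorem2 :
    (∀ X : PrecubicalSet.{u}, X.Sculptable ↔ X.IsEuclidean) ∧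
    (∀ Q : HDA.{u}, Q.Connected → (Q.Sculptable ↔ Q.toPrecubicalSet.IsEuclidean)) := by
  refine ⟨PrecubicalSet.sculptable_iff_isEuclidean, fun Q hQ => ?_⟩
  rw [← PrecubicalSet.sculptable_iff_isEuclidean]
  exact ⟨fun ⟨d, f, hf, _⟩ => ⟨d, f, hf⟩, hQ.sculptable⟩
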